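/- Fix an integer $d\ge 3$, a real number $t>0$ and $z\in\mathbb{C}$ with $\operatorname{Im} z>0$. Throughout, $N$ ranges over the integers with $N\ge d+1$ and $Nd$ even, and $N\to\infty$ is taken along these values. For each such $N$ let $W_{N,t}=-tA_N+\operatorname{diag}(g_1,\dots,g_N)$, where $A_N$ is the adjacency matrix of a uniformly random simple $d$-regular graph on $\{1,\dots,N\}$ and $g_1,\dots,g_N$ are i.i.d. standard Gaussian random variables independent of the graph, and let $G_N(z)=(W_{N,t}-z)^{-1}$. Let $\mathbb{T}_d$ be the (infinite) $d$-regular tree with vertex set $\mathbb{V}$ and root $0$, let $A$ be its adjacency operator on $\ell^2(\mathbb{V})$, and let $V$ be multiplication by a family $(g_v)_{v\in\mathbb{V}}$ of i.i.d. standard Gaussian random variables, with domain $\{f\in\ell^2(\mathbb{V}): (g_vf(v))_{v\in\mathbb{V}}\in\ell^2(\mathbb{V})\}$. Let $H_{d,t}=-tA+V$ on the domain of $V$, let $R(z)=(H_{d,t}-z)^{-1}$ be its (everywhere defined, bounded) resolvent, and $R_{00}(z)=\langle\delta_0,R(z)\delta_0\rangle$. Then there exist a probability space and, on it, random matrices distributed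 as $W_{N,t}$ for every admissible $N$ and a random operator distributed as $H_{d,t}$ (that is, a coupling of all the $W_{N,t}$ and $H_{d,t}$) such that $$(G_N(z))_{11}\longrightarrow R_{00}(z)\quad\text{in probability as } N\to\infty .$$ -/

import Mathlib

open MeasureTheory ProbabilityTheory Filter
open scoped lp

/-! ### The rooted `d`-regular tree -/

/-- Vertices of the rooted `d`-regular tree: words over `d` letters in which no two consecutive
letters agree. -/
abbrev BetheVertex (d : ℕ) : Type := {l : List (Fin d) // l.IsChain (· ≠ ·)}

/-- The root is the empty word. -/
def betheRoot (d : ℕ) : BetheVertex d := ⟨[], List.isChain_nil⟩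

/-- Two words are adjacent when one arises from the other by adding one letter in front. -/
def betheTree (d : ℕ) : SimpleGraph (BetheVertex d) where
  Adj u v := (∃ a, v.1 = a :: u.1) ∨ (∃ a, u.1 = a :: v.1)
  symm := ⟨fun _ _ h => h.symm⟩
  loopless := ⟨by
    rintro u (⟨a, h⟩ | ⟨a, h⟩) <;> simpa using congrArg List.length h⟩

/-- Remove the letter `a` in front of a word if it is there, and add it otherwise. As `a` varies,
this lists the neighbours of the word, each of them once. -/
def betheFlip {d : ℕ} (a : Fin d) (v : BetheVertex d) : BetheVertex d :=
  if h : v.1.head? = some a then ⟨v.1.tail, v.2.tail⟩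
  else ⟨a :: v.1, by
    rw [List.isChain_cons]
    refine ⟨?_, v.2⟩
    rintro b hb rfl
    exact h hb⟩

theorem betheFlip_flip {d : ℕ} (a : Fin d) (v : BetheVertex d) :
    betheFlip a (betheFlip a v) = v := by
  obtain ⟨l, hl⟩ := v
  rcases l with _ | ⟨b, l⟩
  · simp [betheFlip]
  · by_cases h : b = a
    · subst h
      have : l.head? ≠ some b := by
        intro h'
        rw [List.isChain_cons] at hl
        exact hl.1 b h' rfl
      simp [betheFlip, this]
    · simp [betheFlip, h]

theorem betheTree_adj_iff {d : ℕ} (v w : BetheVertex d) :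
    (betheTree d).Adj v w ↔ ∃ a, betheFlip a v = w := by
  constructor
  · rintro (⟨a, h⟩ | ⟨a, h⟩)
    · refine ⟨a, ?_⟩
      have h1 : v.1.head? ≠ some a := by
        intro h'
        have := w.2
        rw [h, List.isChain_cons] at this
        exact this.1 a h' rfl
      simp only [betheFlip, h1, dite_false]
      exact Subtype.ext h.symm
    · refine ⟨a, ?_⟩
      have h1 : v.1.head? = some a := by simp [h]
      simp only [betheFlip, h1, dite_true]
      exact Subtype.ext (by simp [h])
  · rintro ⟨a, rfl⟩
    by_cases h1 : v.1.head? = some a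
    · right
      refine ⟨a, ?_⟩
      simp only [betheFlip, h1, dite_true]
      exact (List.cons_head?_tail h1).symm
    · left
      refine ⟨a, ?_⟩
      simp only [betheFlip, h1, dite_false]

theorem betheFlip_injective_left {d : ℕ} (v : BetheVertex d) :
    Function.Injective (fun a : Fin d => betheFlip a v) := by
  intro a b hab
  simp only [betheFlip] at hab
  by_cases h1 : v.1.head? = some a <;> by_cases h2 : v.1.head? = some b
  · exact Option.some.inj (h1.symm.trans h2)
  all_goals
    replace hab := congrArg (fun x : BetheVertex d => x.1) hab
    simp only [h1, h2, dite_true, dite_false] at hab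
  · have h3 := congrArg List.length hab
    simp only [dif_neg (h1 ▸ h2), List.length_tail, List.length_cons] at h3
    omega
  · have h3 := congrArg List.length hab
    simp only [dif_neg (h2 ▸ h1), List.length_tail, List.length_cons] at h3
    omega
  · exact (List.cons.inj hab).1

noncomputable instance betheTreeLocallyFinite (d : ℕ) : (betheTree d).LocallyFinite := fun v =>
  ((Set.finite_range (fun a : Fin d => betheFlip a v)).subset (by
    intro w hw
    exact (betheTree_adj_iff v w).1 hw)).fintype

theorem betheTree_neighborFinset (d : ℕ) (v : BetheVertex d) :
    (betheTree d).neighborFinset v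
      = Finset.univ.map ⟨fun a : Fin d => betheFlip a v, betheFlip_injective_left v⟩ := by
  ext w
  simp [betheTree_adj_iff]

theorem betheTree_isRegularOfDegree (d : ℕ) : (betheTree d).IsRegularOfDegree d := by
  intro v
  rw [← SimpleGraph.card_neighborFinset_eq_degree, betheTree_neighborFinset]
  simp

theorem betheTree_isTree (d : ℕ) : (betheTree d).IsTree := by
  have hreach : ∀ v, (betheTree d).Reachable (betheRoot d) v := by
    rintro ⟨l, hl⟩
    induction l with
    | nil => exact SimpleGraph.Reachable.refl _
    | cons a l ih =>
      exact (ih hl.tail).trans (SimpleGraph.Adj.reachable (Or.inl ⟨a, rfl⟩))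
  refine ⟨{ preconnected := fun u v => (hreach u).symm.trans (hreach v), nonempty := ⟨betheRoot d⟩ },
    ?_⟩
  -- in a cycle, both neighbours of a longest word would be its tail
  intro v c hc
  obtain ⟨w, hw, hmax⟩ := c.support.toFinset.exists_max_image (fun x => x.1.length)
    ⟨v, by simp⟩
  rw [List.mem_toFinset] at hw
  have hc' := hc.rotate hw
  set c' := c.rotate w hw with hcc
  have key : ∀ x ∈ c'.support, (betheTree d).Adj w x → x.1 = w.1.tail := by
    intro x hx hadj
    have hx' : x ∈ c.support := by simpa [hcc] using hx
    have := hmax x (by simpa using hx')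
    rcases hadj with ⟨a, h⟩ | ⟨a, h⟩
    · rw [h] at this
      simp at this
    · simp [h]
  have h1 := key _ (SimpleGraph.Walk.getVert_mem_support c' 1)
    (SimpleGraph.Walk.adj_snd hc'.not_nil)
  have h2 := key _ (SimpleGraph.Walk.getVert_mem_support c' _)
    (SimpleGraph.Walk.adj_penultimate hc'.not_nil).symm
  exact hc'.snd_ne_penultimate (Subtype.ext (h1.trans h2.symm))

/-! ### The operator `H = -t A + V` on the tree and its resolvent -/

theorem memlp_betheNeighborSum {d : ℕ} (f : ℓ²(BetheVertex d, ℂ)) :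
    Memℓp (fun v => ∑ w ∈ (betheTree d).neighborFinset v, f w) 2 := by
  have h : ∀ a : Fin d, Memℓp (fun v => f (betheFlip a v)) 2 := by
    intro a
    have hf := lp.memℓp f
    rw [memℓp_gen_iff (by norm_num)] at hf ⊢
    exact hf.comp_injective (Function.LeftInverse.injective (betheFlip_flip a))
  have h2 := Memℓp.finsetSum (p := 2) (E := fun _ : BetheVertex d => ℂ) Finset.univ
    (fun a _ => h a)
  refine cast (congrArg (Memℓp · 2) ?_) h2
  funext v
  simp [betheTree_neighborFinset]

/-- The adjacency operator: `(A f) v` is the sum of `f` over the neighbours of `v`. -/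
noncomputable def betheAdjacency (d : ℕ) : ℓ²(BetheVertex d, ℂ) →ₗ[ℂ] ℓ²(BetheVertex d, ℂ) where
  toFun f := ⟨fun v => ∑ w ∈ (betheTree d).neighborFinset v, f w, memlp_betheNeighborSum f⟩
  map_add' f g := by
    ext v
    exact Finset.sum_add_distrib
  map_smul' c f := by
    ext v
    simp [Finset.mul_sum]

/-- Multiplication by the real potential `g`, with its maximal domain
`{f ∈ ℓ² : g f ∈ ℓ²}`. -/
noncomputable def bethePotential {d : ℕ} (g : BetheVertex d → ℝ) :
    ℓ²(BetheVertex d, ℂ) →ₗ.[ℂ] ℓ²(BetheVertex d, ℂ) where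
  domain :=
    { carrier := {f | Memℓp (fun v => (g v : ℂ) * f v) 2}
      zero_mem' := by
        have h : (fun v => (g v : ℂ) * (0 : ℓ²(BetheVertex d, ℂ)) v) = 0 := by
          funext v
          simp
        change Memℓp _ 2
        rw [h]
        exact zero_memℓp
      add_mem' := by
        intro f₁ f₂ h₁ h₂
        have h : (fun v => (g v : ℂ) * (f₁ + f₂) v)
            = (fun v => (g v : ℂ) * f₁ v) + (fun v => (g v : ℂ) * f₂ v) := by
          funext v
          simp [mul_add]
        change Memℓp _ 2
        rw [h]
        exact Memℓp.add h₁ h₂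
      smul_mem' := by
        intro c f hf
        have h : (fun v => (g v : ℂ) * (c • f) v) = c • (fun v => (g v : ℂ) * f v) := by
          funext v
          simp [mul_left_comm]
        change Memℓp _ 2
        rw [h]
        exact Memℓp.const_smul hf c }
  toFun :=
    { toFun := fun f => ⟨fun v => (g v : ℂ) * (f : ℓ²(BetheVertex d, ℂ)) v, f.2⟩
      map_add' := by
        intro f₁ f₂
        ext v
        exact mul_add _ _ _
      map_smul' := by
        intro c f
        ext v
        simp [mul_left_comm] }

/-- `H = -t A + V` on the domain of the potential `V`, for one realization `g` of the potential. -/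
noncomputable def betheHamiltonian (d : ℕ) (t : ℝ) (g : BetheVertex d → ℝ) :
    ℓ²(BetheVertex d, ℂ) →ₗ.[ℂ] ℓ²(BetheVertex d, ℂ) :=
  (-(t : ℂ) • betheAdjacency d) +ᵥ bethePotential g

/-- `R` is the resolvent `(H - z)⁻¹`: a bounded operator on the whole space that maps into the
domain of `H` and is a two-sided inverse of `H - z` (hence unique). -/
def IsResolventAt {E : Type*} [NormedAddCommGroup E] [NormedSpace ℂ E]
    (H : E →ₗ.[ℂ] E) (z : ℂ) (R : E →L[ℂ] E) : Prop :=
  (∀ f : E, ∃ h : R f ∈ H.domain, H ⟨R f, h⟩ - z • R f = f) ∧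
    ∀ f : H.domain, R (H f - z • (f : E)) = f

/-- The unit vector supported at the vertex `v`. -/
noncomputable def betheDelta {d : ℕ} (v : BetheVertex d) : ℓ²(BetheVertex d, ℂ) := by
  classical exact lp.single 2 v (1 : ℂ)

/-! ### The model on a graph with vertices `0, …, N - 1` -/

/-- The finite set of graphs on `N` vertices carries the discrete `σ`-algebra. -/
instance simpleGraphFinMeasurableSpace (N : ℕ) : MeasurableSpace (SimpleGraph (Fin N)) := ⊤

/-- The admissible numbers of vertices: `N ≥ d + 1` and `N d` even. -/
abbrev RegularSize (d : ℕ) : Type := {N : ℕ // d + 1 ≤ N ∧ Even (N * d)}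

/-- The first vertex, written `1` in `[N] = {1, …, N}`. -/
def firstVertex {d : ℕ} (N : RegularSize d) : Fin N.1 :=
  ⟨0, lt_of_lt_of_le (Nat.succ_pos d) N.2.1⟩

open Classical in
/-- The uniform probability measure on the simple `d`-regular graphs with `N` labelled vertices. -/
noncomputable def uniformRegularGraph (d N : ℕ) : Measure (SimpleGraph (Fin N)) :=
  uniformOn {G | G.IsRegularOfDegree d}

open Classical in
/-- The real symmetric matrix `W = -t A + diag(g)`, `A` the adjacency matrix of `G`. -/
noncomputable def andersonMatrix {N : ℕ} (t : ℝ) (G : SimpleGraph (Fin N)) (g : Fin N → ℝ) :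
    Matrix (Fin N) (Fin N) ℝ :=
  -t • G.adjMatrix ℝ + Matrix.diagonal g

/-- The resolvent `(W - z)⁻¹` of a real matrix; the inverse exists when `W` is symmetric and `z`
is not real. -/
noncomputable def matrixResolvent {N : ℕ} (W : Matrix (Fin N) (Fin N) ℝ) (z : ℂ) :
    Matrix (Fin N) (Fin N) ℂ :=
  (W.map (fun x : ℝ => (x : ℂ)) - z • (1 : Matrix (Fin N) (Fin N) ℂ))⁻¹

/-!
The resolvent entry of a random regular graph converges to the one of the tree because the graph
looks like the tree near its first vertex, and the resolvent entry depends little on what happens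
far away.

*Random regular graphs are locally trees.* Every `d`-regular graph `G` is covered by the tree:
there is a map `φ` from the tree, with the root over the first vertex, that is a bijection from the
neighbours of each `v` to the neighbours of `φ v` (`exists_isBetheCover`). If `φ` is not injective
on the ball of radius `r`, then `G` contains two walks from the first vertex, of bounded length,
whose endpoints are joined by an edge that neither of them uses (`IsBetheCover.injOn_ball`).
Switching this edge with almost any of the `N d / 2` edges of `G` gives a regular graph that still
contains the two walks, and each such graph arises in at most `d²` ways; as a graph has boundedly
many such pairs of walks, the probability that one exists is `O(1 / N)`
(`card_hasExcessEdge_mul_le`).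

*The coupling.* The graphs are independent of the potential `g` on the tree, and the potential on
`G` is `g ∘ σ` for an injection `σ` of the vertices of `G` into the tree that inverts `φ` on the
largest ball where this is possible (`exists_labelling`). As `σ` is injective and depends on `G`
only, `g ∘ σ` is i.i.d. Gaussian and independent of `G`.

*Comparison of the resolvents.* The operator `H - z = (1 - t A (V - z)⁻¹)(V - z)` is invertible for
every real potential, since symmetry of `H` gives the lower bounds `|Im z|` for `H - z` and
`H - z̄` (`exists_isResolventAt`). Finitely supported functions form a core of `H`, so some finitely
supported `f` satisfies `(H - z) f = δ + ε` with `ε` small in `ℓ²` and `f` close to `(H - z)⁻¹ δ` at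
the root (`exists_finsupp_approx`). Pushed forward along `φ`, `f` solves the same equation on `G`,
and the bound `‖(W - z)⁻¹‖ ≤ 1 / Im z` shows that the resolvent entry of `G` is close to the value
of `f` at the root (`IsBetheCover.norm_matrixResolvent_sub_le`). For a fixed potential this gives
convergence in probability over the graphs; the average over the potential converges by dominated
convergence.
-/

/-! ### The Hamiltonian on the tree -/

/-- Two `ℓ²` functions are compared through the sums of their squares. -/
theorem lp_two_norm_le {α β : Type*} (f : ℓ²(α, ℂ)) (h : ℓ²(β, ℂ)) (C : ℝ) (hC : 0 ≤ C)
    (H : ∀ s : Finset α, ∑ v ∈ s, ‖f v‖ ^ 2 ≤ (C * ‖h‖) ^ 2) : ‖f‖ ≤ C * ‖h‖ := by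
  refine lp.norm_le_of_forall_sum_le (by norm_num) (by positivity) fun s => ?_
  simpa using H s

theorem sum_sq_le_lp_norm_sq {α : Type*} (f : ℓ²(α, ℂ)) (s : Finset α) :
    ∑ v ∈ s, ‖f v‖ ^ 2 ≤ ‖f‖ ^ 2 := by
  simpa using lp.sum_rpow_le_norm_rpow (p := 2) (by norm_num) f s

/-- Composition of `ℓ²` functions with the involution `betheFlip a`. -/
noncomputable def betheShift {d : ℕ} (a : Fin d) :
    ℓ²(BetheVertex d, ℂ) →L[ℂ] ℓ²(BetheVertex d, ℂ) :=
  LinearMap.mkContinuous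
    { toFun := fun f => ⟨fun v => f (betheFlip a v), by
        have hf := lp.memℓp f
        change Memℓp _ 2
        rw [memℓp_gen_iff (by norm_num)] at hf ⊢
        exact hf.comp_injective (Function.LeftInverse.injective (betheFlip_flip a))⟩
      map_add' := fun f h => by ext v; rfl
      map_smul' := fun c f => by ext v; rfl } 1 fun f => by
    refine lp_two_norm_le _ _ _ zero_le_one fun s => ?_
    rw [one_mul]
    refine le_trans (le_of_eq ?_) (sum_sq_le_lp_norm_sq f (s.map
      ⟨betheFlip a, Function.LeftInverse.injective (betheFlip_flip a)⟩))
    rw [Finset.sum_map]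
    rfl

@[simp] theorem betheShift_apply {d : ℕ} (a : Fin d) (f : ℓ²(BetheVertex d, ℂ))
    (v : BetheVertex d) : betheShift a f v = f (betheFlip a v) := rfl

/-- The adjacency operator as a bounded operator. -/
noncomputable def betheAdjacencyCLM (d : ℕ) : ℓ²(BetheVertex d, ℂ) →L[ℂ] ℓ²(BetheVertex d, ℂ) :=
  ∑ a : Fin d, betheShift a

theorem betheAdjacency_eq (d : ℕ) (f : ℓ²(BetheVertex d, ℂ)) :
    betheAdjacency d f = betheAdjacencyCLM d f := by
  ext v
  rw [betheAdjacencyCLM, sum_apply, lp.coeFn_sum, Finset.sum_apply]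
  change ∑ w ∈ (betheTree d).neighborFinset v, f w = _
  rw [betheTree_neighborFinset, Finset.sum_map]
  rfl

theorem inner_betheShift {d : ℕ} (a : Fin d) (f h : ℓ²(BetheVertex d, ℂ)) :
    inner ℂ (betheShift a f) h = inner ℂ f (betheShift a h) := by
  rw [lp.inner_eq_tsum, lp.inner_eq_tsum,
    ← (Function.Involutive.toPerm _ (betheFlip_flip a)).tsum_eq]
  refine tsum_congr fun v => ?_
  change inner ℂ (f (betheFlip a (betheFlip a v))) (h (betheFlip a v)) = _
  rw [betheFlip_flip]
  rfl

theorem inner_betheAdjacencyCLM {d : ℕ} (f h : ℓ²(BetheVertex d, ℂ)) :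
    inner ℂ (betheAdjacencyCLM d f) h = inner ℂ f (betheAdjacencyCLM d h) := by
  simp only [betheAdjacencyCLM, sum_apply, sum_inner, inner_sum, inner_betheShift]

theorem mem_betheHamiltonian_domain {d : ℕ} (t : ℝ) (g : BetheVertex d → ℝ)
    (f : ℓ²(BetheVertex d, ℂ)) :
    f ∈ (betheHamiltonian d t g).domain ↔ Memℓp (fun v => (g v : ℂ) * f v) 2 := Iff.rfl

theorem betheHamiltonian_apply {d : ℕ} (t : ℝ) (g : BetheVertex d → ℝ)
    (f : (betheHamiltonian d t g).domain) :
    betheHamiltonian d t g f = -(t : ℂ) • betheAdjacencyCLM d f + bethePotential g f := by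
  rw [← betheAdjacency_eq]
  rfl

/-- The Hamiltonian is symmetric. -/
theorem im_inner_betheHamiltonian {d : ℕ} (t : ℝ) (g : BetheVertex d → ℝ)
    (f : (betheHamiltonian d t g).domain) :
    (inner ℂ (f : ℓ²(BetheVertex d, ℂ)) (betheHamiltonian d t g f)).im = 0 := by
  rw [betheHamiltonian_apply, inner_add_right, inner_smul_right, Complex.add_im]
  have h1 : (inner ℂ (f : ℓ²(BetheVertex d, ℂ)) (betheAdjacencyCLM d f)).im = 0 := by
    have := inner_conj_symm (𝕜 := ℂ) (f : ℓ²(BetheVertex d, ℂ)) (betheAdjacencyCLM d f)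
    rw [inner_betheAdjacencyCLM] at this
    exact Complex.conj_eq_iff_im.1 this
  have h2 : (inner ℂ (f : ℓ²(BetheVertex d, ℂ)) (bethePotential g f)).im = 0 := by
    rw [lp.inner_eq_tsum, Complex.im_tsum (lp.summable_inner _ _)]
    refine (tsum_congr fun v => ?_).trans tsum_zero
    change ((g v * f.1 v) * (starRingEnd ℂ) (f.1 v)).im = 0
    rw [mul_assoc, Complex.mul_conj, ← Complex.ofReal_mul, Complex.ofReal_im]
  have h3 : (-(t : ℂ)).im = 0 := by simp
  rw [Complex.mul_im, h1, h2, h3]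
  simp

/-- `H - z` is bounded below by `|Im z|`. -/
theorem betheHamiltonian_bound {d : ℕ} (t : ℝ) (g : BetheVertex d → ℝ) (z : ℂ)
    (f : (betheHamiltonian d t g).domain) :
    |z.im| * ‖(f : ℓ²(BetheVertex d, ℂ))‖ ≤
      ‖betheHamiltonian d t g f - z • (f : ℓ²(BetheVertex d, ℂ))‖ := by
  set x : ℓ²(BetheVertex d, ℂ) := f.1 with hx
  set y := betheHamiltonian d t g f - z • x with hy
  have h1 : (inner ℂ x y).im = -(z.im * ‖x‖ ^ 2) := by
    rw [hy, inner_sub_right, inner_smul_right, Complex.sub_im, im_inner_betheHamiltonian,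
      inner_self_eq_norm_sq_to_K]
    simp [Complex.mul_im, ← Complex.ofReal_pow]
  have h2 : |z.im| * ‖x‖ ^ 2 ≤ ‖x‖ * ‖y‖ := by
    calc |z.im| * ‖x‖ ^ 2 = |(inner ℂ x y).im| := by
          rw [h1, abs_neg, abs_mul, abs_of_nonneg (sq_nonneg ‖x‖)]
      _ ≤ ‖inner ℂ x y‖ := Complex.abs_im_le_norm _
      _ ≤ ‖x‖ * ‖y‖ := norm_inner_le_norm _ _
  rcases (norm_nonneg x).eq_or_lt with h0 | h0
  · rw [← h0, mul_zero]; exact norm_nonneg _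
  · exact le_of_mul_le_mul_left (by linarith) h0

theorem sub_ne_zero_of_im_ne_zero {z : ℂ} (hz : z.im ≠ 0) (x : ℝ) : (x : ℂ) - z ≠ 0 := by
  intro h
  apply hz
  simpa using congrArg Complex.im h

theorem norm_inv_sub_le {z : ℂ} (hz : z.im ≠ 0) (x : ℝ) : ‖((x : ℂ) - z)⁻¹‖ ≤ |z.im|⁻¹ := by
  rw [norm_inv]
  refine inv_anti₀ (abs_pos.2 hz) ?_
  simpa using Complex.abs_im_le_norm ((x : ℂ) - z)

theorem lp_two_norm_inv_mul_sum_le {d : ℕ} {z : ℂ} (hz : z.im ≠ 0) (g : BetheVertex d → ℝ)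
    (f : ℓ²(BetheVertex d, ℂ)) (s : Finset (BetheVertex d)) :
    ∑ v ∈ s, ‖((g v : ℂ) - z)⁻¹ * f v‖ ^ 2 ≤ (|z.im|⁻¹ * ‖f‖) ^ 2 := by
  calc ∑ v ∈ s, ‖((g v : ℂ) - z)⁻¹ * f v‖ ^ 2 ≤ ∑ v ∈ s, (|z.im|⁻¹) ^ 2 * ‖f v‖ ^ 2 := by
        refine Finset.sum_le_sum fun v _ => ?_
        rw [norm_mul, mul_pow]
        gcongr
        exact norm_inv_sub_le hz _
    _ = (|z.im|⁻¹) ^ 2 * ∑ v ∈ s, ‖f v‖ ^ 2 := by rw [Finset.mul_sum]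
    _ ≤ _ := by
        rw [mul_pow]
        gcongr
        exact sum_sq_le_lp_norm_sq f s

/-- The resolvent of the potential alone: multiplication by `(g - z)⁻¹`. -/
noncomputable def potentialResolvent {d : ℕ} {z : ℂ} (hz : z.im ≠ 0) (g : BetheVertex d → ℝ) :
    ℓ²(BetheVertex d, ℂ) →L[ℂ] ℓ²(BetheVertex d, ℂ) :=
  LinearMap.mkContinuous
    { toFun := fun f => ⟨fun v => ((g v : ℂ) - z)⁻¹ * f v, by
        refine memℓp_gen' (C := (|z.im|⁻¹ * ‖f‖) ^ 2) fun s => ?_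
        simpa using lp_two_norm_inv_mul_sum_le hz g f s⟩
      map_add' := fun f h => by ext v; exact mul_add _ _ _
      map_smul' := fun c f => by ext v; exact mul_left_comm _ _ _ } |z.im|⁻¹ fun f =>
    lp_two_norm_le _ _ _ (by positivity) (lp_two_norm_inv_mul_sum_le hz g f)

@[simp] theorem potentialResolvent_apply {d : ℕ} {z : ℂ} (hz : z.im ≠ 0) (g : BetheVertex d → ℝ)
    (f : ℓ²(BetheVertex d, ℂ)) (v : BetheVertex d) :
    potentialResolvent hz g f v = ((g v : ℂ) - z)⁻¹ * f v := rfl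

theorem potentialResolvent_mem {d : ℕ} {z : ℂ} (hz : z.im ≠ 0) (t : ℝ) (g : BetheVertex d → ℝ)
    (f : ℓ²(BetheVertex d, ℂ)) :
    potentialResolvent hz g f ∈ (betheHamiltonian d t g).domain := by
  rw [mem_betheHamiltonian_domain]
  have : (fun v => (g v : ℂ) * potentialResolvent hz g f v)
      = ((f + z • potentialResolvent hz g f : ℓ²(BetheVertex d, ℂ)) : BetheVertex d → ℂ) := by
    funext v
    have := sub_ne_zero_of_im_ne_zero hz (g v)
    change (g v : ℂ) * (((g v : ℂ) - z)⁻¹ * f v) = f v + z * (((g v : ℂ) - z)⁻¹ * f v)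
    field_simp
    ring
  rw [this]
  exact lp.memℓp _

/-- `(H - z)(V - z)⁻¹ = 1 - t A (V - z)⁻¹`. -/
theorem betheHamiltonian_potentialResolvent {d : ℕ} {z : ℂ} (hz : z.im ≠ 0) (t : ℝ)
    (g : BetheVertex d → ℝ) (f : ℓ²(BetheVertex d, ℂ))
    (hf : potentialResolvent hz g f ∈ (betheHamiltonian d t g).domain) :
    betheHamiltonian d t g ⟨potentialResolvent hz g f, hf⟩ - z • potentialResolvent hz g f
      = f - (t : ℂ) • betheAdjacencyCLM d (potentialResolvent hz g f) := by
  rw [betheHamiltonian_apply]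
  ext v
  have := sub_ne_zero_of_im_ne_zero hz (g v)
  change -(t : ℂ) * betheAdjacencyCLM d (potentialResolvent hz g f) v
      + (g v : ℂ) * (((g v : ℂ) - z)⁻¹ * f v) - z * (((g v : ℂ) - z)⁻¹ * f v)
    = f v - t * betheAdjacencyCLM d (potentialResolvent hz g f) v
  field_simp
  ring

theorem inner_potentialResolvent {d : ℕ} {z : ℂ} (hz : z.im ≠ 0)
    (hz' : ((starRingEnd ℂ) z).im ≠ 0) (g : BetheVertex d → ℝ) (f h : ℓ²(BetheVertex d, ℂ)) :
    inner ℂ (potentialResolvent hz g f) h = inner ℂ f (potentialResolvent hz' g h) := by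
  rw [lp.inner_eq_tsum, lp.inner_eq_tsum]
  refine tsum_congr fun v => ?_
  simp
  ring

/-- The operator `H - z` precomposed with `(V - z)⁻¹`, as a bounded operator. -/
noncomputable def resolventFactor {d : ℕ} {z : ℂ} (hz : z.im ≠ 0) (t : ℝ)
    (g : BetheVertex d → ℝ) : ℓ²(BetheVertex d, ℂ) →L[ℂ] ℓ²(BetheVertex d, ℂ) :=
  ContinuousLinearMap.id ℂ _ - (t : ℂ) • (betheAdjacencyCLM d).comp (potentialResolvent hz g)

theorem resolventFactor_apply {d : ℕ} {z : ℂ} (hz : z.im ≠ 0) (t : ℝ)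
    (g : BetheVertex d → ℝ) (f : ℓ²(BetheVertex d, ℂ)) :
    resolventFactor hz t g f = f - (t : ℂ) • betheAdjacencyCLM d (potentialResolvent hz g f) := rfl

/-- The lower bound for `H - z` makes the factor bounded below, the one for `H - z̄` makes the
kernel of its adjoint trivial. -/
theorem resolventFactor_bijective {d : ℕ} {z : ℂ} (hz : z.im ≠ 0) (t : ℝ)
    (g : BetheVertex d → ℝ) : Function.Bijective (resolventFactor hz t g) := by
  rw [ContinuousLinearMap.bijective_iff_dense_range_and_antilipschitz]
  constructor
  · rw [Submodule.topologicalClosure_eq_top_iff, Submodule.eq_bot_iff]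
    intro y hy
    have hz' : ((starRingEnd ℂ) z).im ≠ 0 := by simpa using hz
    have h1 : y - (t : ℂ) • potentialResolvent hz' g (betheAdjacencyCLM d y) = 0 := by
      refine ext_inner_left ℂ fun u => ?_
      have := (Submodule.mem_orthogonal _ _).1 hy (resolventFactor hz t g u) ⟨u, rfl⟩
      rw [resolventFactor_apply, inner_sub_left, inner_smul_left, inner_betheAdjacencyCLM,
        inner_potentialResolvent hz hz'] at this
      rw [inner_sub_right, inner_smul_right, inner_zero_right, ← this]
      simp
    have h2 : y = potentialResolvent hz' g ((t : ℂ) • betheAdjacencyCLM d y) := by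
      rw [map_smul]
      exact sub_eq_zero.1 h1
    have hmem : y ∈ (betheHamiltonian d t g).domain := by
      rw [h2]
      exact potentialResolvent_mem hz' t g _
    have h3 : betheHamiltonian d t g ⟨y, hmem⟩ - (starRingEnd ℂ) z • y = 0 := by
      have h4 := betheHamiltonian_potentialResolvent hz' t g ((t : ℂ) • betheAdjacencyCLM d y)
        (h2 ▸ hmem)
      simp only [← h2] at h4
      rw [h4, sub_self]
    have h4 := betheHamiltonian_bound t g ((starRingEnd ℂ) z) ⟨y, hmem⟩
    simp only [h3, norm_zero] at h4
    have h5 : 0 < |((starRingEnd ℂ) z).im| := abs_pos.2 hz'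
    exact norm_le_zero_iff.1 (nonpos_of_mul_nonpos_right h4 h5)
  · set C : ℝ := 1 + ‖(t : ℂ)‖ * (‖betheAdjacencyCLM d‖ * |z.im|⁻¹) with hC
    have hC0 : 0 ≤ C := by positivity
    refine ⟨⟨C, hC0⟩, AddMonoidHomClass.antilipschitz_of_bound _ fun u => ?_⟩
    change ‖u‖ ≤ C * _
    have h1 := betheHamiltonian_bound t g z ⟨_, potentialResolvent_mem hz t g u⟩
    rw [betheHamiltonian_potentialResolvent, ← resolventFactor_apply] at h1
    change |z.im| * ‖potentialResolvent hz g u‖ ≤ _ at h1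
    have h2 : ‖potentialResolvent hz g u‖ ≤ |z.im|⁻¹ * ‖resolventFactor hz t g u‖ := by
      rw [inv_mul_eq_div, le_div_iff₀' (abs_pos.2 hz)]
      exact h1
    have h3 : u = resolventFactor hz t g u
        + (t : ℂ) • betheAdjacencyCLM d (potentialResolvent hz g u) := by
      rw [resolventFactor_apply, sub_add_cancel]
    calc ‖u‖ ≤ ‖resolventFactor hz t g u‖
          + ‖(t : ℂ) • betheAdjacencyCLM d (potentialResolvent hz g u)‖ := by
          conv_lhs => rw [h3]
          exact norm_add_le _ _
      _ ≤ ‖resolventFactor hz t g u‖ + ‖(t : ℂ)‖ * (‖betheAdjacencyCLM d‖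
          * (|z.im|⁻¹ * ‖resolventFactor hz t g u‖)) := by
          rw [norm_smul]
          gcongr
          exact (ContinuousLinearMap.le_opNorm _ _).trans (by gcongr)
      _ = C * ‖resolventFactor hz t g u‖ := by rw [hC]; ring

theorem betheHamiltonian_sub_injective {d : ℕ} {z : ℂ} (hz : z.im ≠ 0) (t : ℝ)
    (g : BetheVertex d → ℝ) (f h : (betheHamiltonian d t g).domain)
    (hfh : betheHamiltonian d t g f - z • (f : ℓ²(BetheVertex d, ℂ))
      = betheHamiltonian d t g h - z • (h : ℓ²(BetheVertex d, ℂ))) : f = h := by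
  have h1 := betheHamiltonian_bound t g z (f - h)
  rw [LinearPMap.map_sub, AddSubgroupClass.coe_sub, smul_sub, sub_sub_sub_comm, hfh, sub_self,
    norm_zero] at h1
  have h2 := norm_le_zero_iff.1 (nonpos_of_mul_nonpos_right h1 (abs_pos.2 hz))
  exact Subtype.ext (sub_eq_zero.1 h2)

/-- The tree Hamiltonian has a resolvent at every non-real point, whatever the potential. -/
theorem exists_isResolventAt {d : ℕ} {z : ℂ} (hz : z.im ≠ 0) (t : ℝ)
    (g : BetheVertex d → ℝ) : ∃ R, IsResolventAt (betheHamiltonian d t g) z R := by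
  obtain ⟨S, hS⟩ : ∃ S : ℓ²(BetheVertex d, ℂ) →L[ℂ] ℓ²(BetheVertex d, ℂ),
      ∀ f, resolventFactor hz t g (S f) = f := by
    have hb := resolventFactor_bijective hz t g
    exact ⟨(ContinuousLinearEquiv.ofBijective (resolventFactor hz t g)
      (LinearMap.ker_eq_bot.2 hb.1) (LinearMap.range_eq_top.2 hb.2)).symm,
      ContinuousLinearEquiv.ofBijective_apply_symm_apply _ _ _⟩
  have key : ∀ f : ℓ²(BetheVertex d, ℂ),
      ∃ h : potentialResolvent hz g (S f) ∈ (betheHamiltonian d t g).domain,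
        betheHamiltonian d t g ⟨potentialResolvent hz g (S f), h⟩
          - z • potentialResolvent hz g (S f) = f := fun f =>
    ⟨potentialResolvent_mem hz t g _, by
      rw [betheHamiltonian_potentialResolvent, ← resolventFactor_apply, hS]⟩
  refine ⟨(potentialResolvent hz g).comp S, key, fun f => ?_⟩
  obtain ⟨h, hh⟩ := key (betheHamiltonian d t g f - z • (f : ℓ²(BetheVertex d, ℂ)))
  exact congrArg Subtype.val (betheHamiltonian_sub_injective hz t g ⟨_, h⟩ f hh)

/-! ### Finitely supported functions on the tree -/

theorem betheDelta_apply {d : ℕ} (v w : BetheVertex d) :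
    betheDelta v w = if w = v then 1 else 0 := by
  classical
  unfold betheDelta
  rw [lp.single_apply, Pi.single_apply]

theorem betheShift_betheDelta {d : ℕ} (a : Fin d) (v : BetheVertex d) :
    betheShift a (betheDelta v) = betheDelta (betheFlip a v) := by
  ext w
  have : betheFlip a w = v ↔ w = betheFlip a v :=
    ⟨fun h => by rw [← h, betheFlip_flip], fun h => by rw [h, betheFlip_flip]⟩
  rw [betheShift_apply, betheDelta_apply, betheDelta_apply]
  simp only [this]

/-- The operator `H - z` on finitely supported functions. -/
noncomputable def finsuppHamiltonian {d : ℕ} (t : ℝ) (z : ℂ) (g : BetheVertex d → ℝ) :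
    (BetheVertex d →₀ ℂ) →ₗ[ℂ] (BetheVertex d →₀ ℂ) :=
  Finsupp.linearCombination ℂ fun v => Finsupp.single v ((g v : ℂ) - z)
    - (t : ℂ) • ∑ a : Fin d, Finsupp.single (betheFlip a v) 1

/-- Finitely supported functions as elements of `ℓ²`. -/
noncomputable def finsuppToLp (d : ℕ) : (BetheVertex d →₀ ℂ) →ₗ[ℂ] ℓ²(BetheVertex d, ℂ) :=
  Finsupp.linearCombination ℂ betheDelta

theorem finsuppToLp_single {d : ℕ} (v : BetheVertex d) (c : ℂ) :
    finsuppToLp d (Finsupp.single v c) = c • betheDelta v :=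
  Finsupp.linearCombination_single _ _ _

@[simp] theorem finsuppToLp_apply {d : ℕ} (f : BetheVertex d →₀ ℂ) (v : BetheVertex d) :
    finsuppToLp d f v = f v := by
  induction f using Finsupp.induction_linear with
  | zero => simp
  | add f h hf hh => rw [map_add, lp.coeFn_add, Pi.add_apply, hf, hh, Finsupp.add_apply]
  | single w c =>
    rw [finsuppToLp_single, lp.coeFn_smul, Pi.smul_apply, betheDelta_apply, Finsupp.single_apply]
    simp [eq_comm]

theorem finsuppToLp_finsuppHamiltonian_single {d : ℕ} (t : ℝ) (z : ℂ) (g : BetheVertex d → ℝ)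
    (v : BetheVertex d) (c : ℂ) :
    finsuppToLp d (finsuppHamiltonian t z g (Finsupp.single v c))
      = ((g v : ℂ) * c) • betheDelta v - z • (c • betheDelta v)
        - (t : ℂ) • betheAdjacencyCLM d (c • betheDelta v) := by
  rw [finsuppHamiltonian, Finsupp.linearCombination_single]
  simp only [betheAdjacencyCLM, map_smul, map_sub, map_sum, finsuppToLp_single, sum_apply,
    betheShift_betheDelta, one_smul]
  module

theorem hasSum_smul_betheDelta {d : ℕ} (f : ℓ²(BetheVertex d, ℂ)) :
    HasSum (fun v => f v • betheDelta v) f := by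
  classical
  convert lp.hasSum_single (p := 2) (by norm_num) f using 2 with v
  ext w
  rw [lp.coeFn_smul, Pi.smul_apply, betheDelta_apply, lp.single_apply, Pi.single_apply]
  split_ifs with h
  · subst h; simp
  · simp

/-- Finitely supported functions form a core of `H`, hence they solve `(H - z) f = δ` up to a
small error; such an `f` is close to the resolvent applied to `δ`. -/
theorem exists_finsupp_approx {d : ℕ} {t : ℝ} {z : ℂ} {g : BetheVertex d → ℝ}
    {R : ℓ²(BetheVertex d, ℂ) →L[ℂ] ℓ²(BetheVertex d, ℂ)}
    (hR : IsResolventAt (betheHamiltonian d t g) z R) {ε : ℝ} (hε : 0 < ε) :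
    ∃ f : BetheVertex d →₀ ℂ,
      ‖finsuppToLp d (finsuppHamiltonian t z g f - Finsupp.single (betheRoot d) 1)‖ < ε ∧
      ‖f (betheRoot d)
        - inner ℂ (betheDelta (betheRoot d)) (R (betheDelta (betheRoot d)))‖ < ε := by
  classical
  set ψ := R (betheDelta (betheRoot d)) with hψ
  obtain ⟨hdom, hsol⟩ := hR.1 (betheDelta (betheRoot d))
  rw [← hψ] at hdom
  simp only [← hψ] at hsol
  set y := bethePotential g ⟨ψ, hdom⟩ with hy
  have h1 : betheDelta (betheRoot d) = y - z • ψ - (t : ℂ) • betheAdjacencyCLM d ψ := by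
    refine hsol.symm.trans ?_
    rw [betheHamiltonian_apply]
    symm
    change y - z • ψ - (t : ℂ) • betheAdjacencyCLM d ψ
      = -(t : ℂ) • betheAdjacencyCLM d ψ + y - z • ψ
    rw [neg_smul]
    abel
  have hψs := hasSum_smul_betheDelta ψ
  have hys := hasSum_smul_betheDelta y
  have hlim := (hys.sub (hψs.const_smul z)).sub
    (((betheAdjacencyCLM d).hasSum hψs).const_smul (t : ℂ))
  rw [← h1] at hlim
  have hroot : inner ℂ (betheDelta (betheRoot d)) ψ = ψ (betheRoot d) := by
    have : betheDelta (betheRoot d) = lp.single 2 (betheRoot d) (1 : ℂ) := by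
      ext w
      rw [betheDelta_apply, lp.single_apply, Pi.single_apply]
    rw [this, lp.inner_single_left]
    simp
  have e1 := (Metric.tendsto_nhds.1 hlim) ε hε
  obtain ⟨s, hs1, hs2⟩ := (e1.and (eventually_ge_atTop {betheRoot d})).exists
  refine ⟨∑ v ∈ s, Finsupp.single v (ψ v), ?_, ?_⟩
  · rw [dist_eq_norm] at hs1
    refine lt_of_eq_of_lt (congrArg norm ?_) hs1
    rw [map_sub, map_sum, map_sum, finsuppToLp_single, one_smul]
    congr 1
    refine Finset.sum_congr rfl fun v _ => ?_
    rw [finsuppToLp_finsuppHamiltonian_single]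
    rfl
  · have hmem : betheRoot d ∈ s := hs2 (Finset.mem_singleton_self _)
    have : (∑ v ∈ s, Finsupp.single v (ψ v)) (betheRoot d) = ψ (betheRoot d) := by
      rw [Finsupp.finsetSum_apply, Finset.sum_eq_single_of_mem _ hmem]
      · simp
      · intro b _ hb
        exact Finsupp.single_eq_of_ne' hb
    rw [this, hroot, sub_self, norm_zero]
    exact hε

/-! ### Comparison with finite graphs -/

/-- `φ` is a covering of the graph `G` by the `d`-regular tree: around every vertex of the tree it
maps the `d` neighbours bijectively onto the neighbours of the image. -/
structure IsBetheCover {d : ℕ} {V : Type*} (G : SimpleGraph V) (φ : BetheVertex d → V) : Prop where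
  injective : ∀ v, Function.Injective fun a => φ (betheFlip a v)
  adj_iff : ∀ v x, G.Adj (φ v) x ↔ ∃ a, φ (betheFlip a v) = x

/-- `W - z` as a complex matrix. -/
noncomputable def shiftedAnderson {N : ℕ} (t : ℝ) (G : SimpleGraph (Fin N)) (V : Fin N → ℝ)
    (z : ℂ) : Matrix (Fin N) (Fin N) ℂ :=
  (andersonMatrix t G V).map (fun x : ℝ => (x : ℂ)) - z • (1 : Matrix (Fin N) (Fin N) ℂ)

open Classical in
theorem shiftedAnderson_apply {N : ℕ} (t : ℝ) (G : SimpleGraph (Fin N)) (V : Fin N → ℝ)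
    (z : ℂ) (x y : Fin N) : shiftedAnderson t G V z x y
      = (if x = y then (V y : ℂ) - z else 0) - t * (if G.Adj y x then 1 else 0) := by
  simp only [shiftedAnderson, andersonMatrix, Matrix.sub_apply, Matrix.map_apply, Matrix.add_apply,
    Matrix.smul_apply, SimpleGraph.adjMatrix_apply, Matrix.diagonal_apply, Matrix.one_apply,
    G.adj_comm x y]
  split_ifs with h1 h2 h2 <;> simp_all

open Classical in
theorem IsBetheCover.sum_single {d : ℕ} {V : Type*} {G : SimpleGraph V}
    {φ : BetheVertex d → V} (hφ : IsBetheCover G φ) (v : BetheVertex d) (x : V) :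
    (∑ a : Fin d, (Finsupp.single (φ (betheFlip a v)) (1 : ℂ)) x)
      = if G.Adj (φ v) x then 1 else 0 := by
  split_ifs with h
  · obtain ⟨a, rfl⟩ := (hφ.adj_iff v x).1 h
    rw [Finset.sum_eq_single_of_mem a (Finset.mem_univ _)]
    · simp
    · intro b _ hb
      exact Finsupp.single_eq_of_ne' fun h' => hb (hφ.injective v h')
  · refine Finset.sum_eq_zero fun a _ => Finsupp.single_eq_of_ne' fun h' => h ?_
    exact (hφ.adj_iff v x).2 ⟨a, h'⟩

/-- Pushing forward along a covering intertwines `H - z` with `W - z`, as long as the potentials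
agree on the support. -/
theorem IsBetheCover.mulVec_mapDomain {d N : ℕ} {G : SimpleGraph (Fin N)}
    {φ : BetheVertex d → Fin N} (hφ : IsBetheCover G φ) (t : ℝ) (z : ℂ) (V : Fin N → ℝ)
    (g : BetheVertex d → ℝ) (f : BetheVertex d →₀ ℂ) (hV : ∀ v ∈ f.support, V (φ v) = g v) :
    (shiftedAnderson t G V z).mulVec (f.mapDomain φ)
      = (finsuppHamiltonian t z g f).mapDomain φ := by
  classical
  have h1 : ∀ v ∈ f.support, ∀ x,
      (shiftedAnderson t G V z).mulVec (Finsupp.single (φ v) (f v)) x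
        = (finsuppHamiltonian t z g (Finsupp.single v (f v))).mapDomain φ x := by
    intro v hv x
    rw [Finsupp.single_eq_pi_single, Matrix.mulVec_single, finsuppHamiltonian,
      Finsupp.linearCombination_single]
    change shiftedAnderson t G V z x (φ v) * f v = _
    rw [shiftedAnderson_apply, hV v hv, ← hφ.sum_single]
    rw [← Finsupp.lmapDomain_apply ℂ ℂ]
    simp only [map_smul, map_sub, map_sum, Finsupp.lmapDomain_apply, Finsupp.mapDomain_single,
      Finsupp.smul_apply, Finsupp.sub_apply, Finsupp.finsetSum_apply, smul_eq_mul]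
    rw [Finsupp.single_apply]
    simp only [eq_comm (a := φ v) (b := x)]
    ring
  have h2 : f = ∑ v ∈ f.support, Finsupp.single v (f v) := (Finsupp.sum_single f).symm
  have h3 : ⇑(f.mapDomain φ) = ∑ v ∈ f.support, ⇑(Finsupp.single (φ v) (f v)) := by
    conv_lhs => rw [h2]
    rw [← Finsupp.lmapDomain_apply ℂ ℂ, map_sum, Finsupp.coe_finsetSum]
    simp
  have h4 : ⇑((finsuppHamiltonian t z g f).mapDomain φ) = ∑ v ∈ f.support,
      ⇑((finsuppHamiltonian t z g (Finsupp.single v (f v))).mapDomain φ) := by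
    conv_lhs => rw [h2]
    rw [← Finsupp.lmapDomain_apply ℂ ℂ, map_sum, map_sum, Finsupp.coe_finsetSum]
    simp
  rw [h3, h4, Matrix.mulVec_sum]
  exact Finset.sum_congr rfl fun v hv => funext (h1 v hv)

theorem shiftedAnderson_bound {N : ℕ} (t : ℝ) (G : SimpleGraph (Fin N)) (V : Fin N → ℝ)
    {z : ℂ} (hz : 0 < z.im) (u : Fin N → ℂ) :
    z.im ^ 2 * ∑ x, ‖u x‖ ^ 2 ≤ ∑ x, ‖(shiftedAnderson t G V z).mulVec u x‖ ^ 2 := by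
  set w := (shiftedAnderson t G V z).mulVec u with hw
  have hH : ((andersonMatrix t G V).map (fun x : ℝ => (x : ℂ))).IsHermitian := by
    ext i j
    by_cases h : i = j
    · subst h
      simp [andersonMatrix]
    · by_cases h' : G.Adj i j
      · simp [andersonMatrix, h, Ne.symm h, h', h'.symm]
      · have h'' : ¬G.Adj j i := fun h'' => h' h''.symm
        simp [andersonMatrix, h, Ne.symm h, h', h'']
  have h1 : (star u ⬝ᵥ w).im = -(z.im * ∑ x, ‖u x‖ ^ 2) := by
    have h2 : (star u ⬝ᵥ u) = ((∑ x, ‖u x‖ ^ 2 : ℝ) : ℂ) := by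
      simp only [dotProduct, Pi.star_apply]
      push_cast
      refine Finset.sum_congr rfl fun x _ => ?_
      rw [RCLike.star_def, Complex.conj_mul']
    have h3 := hH.im_star_dotProduct_mulVec_self u
    rw [hw, shiftedAnderson, Matrix.sub_mulVec, dotProduct_sub, Complex.sub_im, Matrix.smul_mulVec,
      Matrix.one_mulVec, dotProduct_smul, h2]
    change (star u ⬝ᵥ _).im = 0 at h3
    rw [h3, smul_eq_mul, Complex.im_mul_ofReal, zero_sub]
  have h2 : z.im * ∑ x, ‖u x‖ ^ 2 ≤ ∑ x, ‖u x‖ * ‖w x‖ := by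
    calc z.im * ∑ x, ‖u x‖ ^ 2 ≤ |(star u ⬝ᵥ w).im| := by
          rw [h1, abs_neg]; exact le_abs_self _
      _ ≤ ‖star u ⬝ᵥ w‖ := Complex.abs_im_le_norm _
      _ ≤ ∑ x, ‖star u x * w x‖ := norm_sum_le _ _
      _ = _ := by simp
  have h3 : 2 * z.im * ∑ x, ‖u x‖ * ‖w x‖ ≤ z.im ^ 2 * ∑ x, ‖u x‖ ^ 2 + ∑ x, ‖w x‖ ^ 2 := by
    rw [Finset.mul_sum, Finset.mul_sum, ← Finset.sum_add_distrib]
    refine Finset.sum_le_sum fun x _ => ?_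
    nlinarith [sq_nonneg (z.im * ‖u x‖ - ‖w x‖)]
  nlinarith

theorem isUnit_det_shiftedAnderson {N : ℕ} (t : ℝ) (G : SimpleGraph (Fin N)) (V : Fin N → ℝ)
    {z : ℂ} (hz : 0 < z.im) : IsUnit (shiftedAnderson t G V z).det := by
  rw [isUnit_iff_ne_zero]
  intro h
  obtain ⟨u, hu0, hu⟩ := Matrix.exists_mulVec_eq_zero_iff.2 h
  have h1 := shiftedAnderson_bound t G V hz u
  rw [hu] at h1
  simp only [Pi.zero_apply, norm_zero, ne_eq, OfNat.ofNat_ne_zero, not_false_eq_true, zero_pow,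
    Finset.sum_const_zero] at h1
  apply hu0
  have h2 : ∑ x, ‖u x‖ ^ 2 ≤ 0 := nonpos_of_mul_nonpos_right h1 (by positivity)
  have h3 := (Finset.sum_eq_zero_iff_of_nonneg (fun x _ => by positivity)).1
    (le_antisymm h2 (Finset.sum_nonneg fun x _ => by positivity))
  funext x
  simpa using h3 x (Finset.mem_univ x)

/-- The comparison of resolvents: if a covering of `G` based at `x` is injective on the ball of
radius `r`, and the potentials agree there, then every approximate solution of `(H - z) f = δ`
supported inside the ball approximates the diagonal entry of the resolvent of `G` at `x`. -/
theorem IsBetheCover.norm_matrixResolvent_sub_le {d N : ℕ} {G : SimpleGraph (Fin N)}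
    {φ : BetheVertex d → Fin N} (hφ : IsBetheCover G φ) (t : ℝ) {z : ℂ} (hz : 0 < z.im)
    (V : Fin N → ℝ) (g : BetheVertex d → ℝ) (f : BetheVertex d →₀ ℂ)
    (S : Set (BetheVertex d)) (hinj : Set.InjOn φ S) (hV : ∀ v ∈ S, V (φ v) = g v)
    (hroot : betheRoot d ∈ S) (hf : ∀ v ∈ f.support, v ∈ S)
    (hHf : ∀ v ∈ (finsuppHamiltonian t z g f).support, v ∈ S) :
    z.im * ‖matrixResolvent (andersonMatrix t G V) z (φ (betheRoot d)) (φ (betheRoot d))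
      - f (betheRoot d)‖
      ≤ ‖finsuppToLp d (finsuppHamiltonian t z g f - Finsupp.single (betheRoot d) 1)‖ := by
  classical
  set K := shiftedAnderson t G V z with hK
  set o := φ (betheRoot d) with ho
  set h := finsuppHamiltonian t z g f - Finsupp.single (betheRoot d) 1 with hh
  set u : Fin N → ℂ := K⁻¹.col o - f.mapDomain φ with hu
  -- `u` is the error of the approximate solution, so `K u` is its residual
  have hKu : K.mulVec u = -⇑(h.mapDomain φ) := by
    have h1 : ⇑(h.mapDomain φ) = ⇑((finsuppHamiltonian t z g f).mapDomain φ) - Pi.single o 1 := by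
      rw [hh, ← Finsupp.lmapDomain_apply ℂ ℂ, map_sub, Finsupp.coe_sub]
      simp [Finsupp.single_eq_pi_single, ho]
    have h2 : K.mulVec (K⁻¹.col o) = Pi.single o 1 := by
      rw [← Matrix.mulVec_single_one, Matrix.mulVec_mulVec,
        Matrix.mul_nonsing_inv _ (isUnit_det_shiftedAnderson t G V hz), Matrix.one_mulVec]
    rw [hu, Matrix.mulVec_sub, h2, hφ.mulVec_mapDomain t z V g f fun v hv => hV v (hf v hv), h1]
    abel
  have hsupp : ↑h.support ⊆ S := by
    intro v hv
    by_contra hvS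
    have h1 : v ∉ (finsuppHamiltonian t z g f).support := fun h' => hvS (hHf v h')
    have h2 : v ≠ betheRoot d := fun h' => hvS (h' ▸ hroot)
    apply Finsupp.mem_support_iff.1 hv
    rw [hh, Finsupp.sub_apply, Finsupp.notMem_support_iff.1 h1, Finsupp.single_eq_of_ne h2,
      sub_zero]
  have hnorm : ∑ x, ‖h.mapDomain φ x‖ ^ 2 ≤ ‖finsuppToLp d h‖ ^ 2 := by
    refine le_trans (le_of_eq ?_) (sum_sq_le_lp_norm_sq (finsuppToLp d h) h.support)
    rw [← Finset.sum_subset (Finset.subset_univ (h.support.image φ)), Finset.sum_image]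
    · refine Finset.sum_congr rfl fun v hv => ?_
      rw [Finsupp.mapDomain_apply' S h hsupp hinj (hsupp hv), finsuppToLp_apply]
    · exact hinj.mono hsupp
    · intro x _ hx
      rw [Finsupp.notMem_support_iff.1 fun h' => hx (Finsupp.mapDomain_support h')]
      simp
  have hb := shiftedAnderson_bound t G V hz u
  rw [← hK, hKu] at hb
  simp only [Pi.neg_apply, norm_neg] at hb
  have h0 : u o = matrixResolvent (andersonMatrix t G V) z o o - f (betheRoot d) := by
    rw [hu, Pi.sub_apply, ho, Finsupp.mapDomain_apply' S f (fun v hv => hf v hv) hinj hroot]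
    rfl
  rw [← h0]
  refine (sq_le_sq₀ (by positivity) (norm_nonneg _)).1 ?_
  rw [mul_pow]
  calc z.im ^ 2 * ‖u o‖ ^ 2 ≤ z.im ^ 2 * ∑ x, ‖u x‖ ^ 2 := by
        gcongr
        exact Finset.single_le_sum (f := fun x => ‖u x‖ ^ 2) (fun x _ => by positivity)
          (Finset.mem_univ o)
    _ ≤ _ := hb.trans hnorm

/-! ### Coverings of regular graphs by the tree -/

theorem isRegularOfDegree_iff_ncard {V : Type*} (G : SimpleGraph V) {_ : G.LocallyFinite} (d : ℕ) :
    G.IsRegularOfDegree d ↔ ∀ x, (G.neighborSet x).ncard = d := by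
  refine forall_congr' fun x => ?_
  rw [← SimpleGraph.card_neighborSet_eq_degree, Set.ncard_eq_toFinset_card', Set.toFinset_card]

theorem exists_enumeration {d : ℕ} {V : Type*} [Finite V] {G : SimpleGraph V}
    (hG : ∀ x, (G.neighborSet x).ncard = d) (x : V) :
    ∃ e : Fin d → V, Function.Injective e ∧ ∀ y, G.Adj x y ↔ ∃ a, e a = y := by
  obtain ⟨e⟩ : Nonempty (G.neighborSet x ≃ Fin d) :=
    ⟨Finite.equivFinOfCardEq (by rw [Nat.card_coe_set_eq, hG])⟩
  refine ⟨fun a => (e.symm a : V), fun a b hab => e.symm.injective (Subtype.ext hab), fun y => ?_⟩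
  constructor
  · intro h
    exact ⟨e ⟨y, h⟩, by simp⟩
  · rintro ⟨a, rfl⟩
    exact (e.symm a).2

theorem exists_enumeration_apply_eq {d : ℕ} {V : Type*} [Finite V] {G : SimpleGraph V}
    (hG : ∀ x, (G.neighborSet x).ncard = d) {x y : V} (hxy : G.Adj x y) (a : Fin d) :
    ∃ e : Fin d → V, Function.Injective e ∧ (∀ y, G.Adj x y ↔ ∃ a, e a = y) ∧ e a = y := by
  obtain ⟨e, he, hadj⟩ := exists_enumeration hG x
  obtain ⟨b, hb⟩ := (hadj y).1 hxy
  refine ⟨e ∘ Equiv.swap a b, he.comp (Equiv.injective _), fun w => ?_, by simpa using hb⟩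
  rw [hadj]
  exact ((Equiv.swap a b).exists_congr_left.trans (by simp)).symm

/-- Every `d`-regular finite graph is covered by the `d`-regular tree, with the root over any given
vertex. The covering is built along words: each word carries its image together with an
enumeration of the neighbours of the image. -/
theorem exists_isBetheCover {d : ℕ} {V : Type*} [Finite V] {G : SimpleGraph V}
    (hG : ∀ x, (G.neighborSet x).ncard = d) (o : V) :
    ∃ φ : BetheVertex d → V, IsBetheCover G φ ∧ φ (betheRoot d) = o := by
  let S := {s : V × (Fin d → V) // Function.Injective s.2 ∧ ∀ y, G.Adj s.1 y ↔ ∃ a, s.2 a = y}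
  have hstep : ∀ (s : S) (a : Fin d), ∃ s' : S, s'.1.1 = s.1.2 a ∧ s'.1.2 a = s.1.1 := by
    rintro ⟨⟨x, e⟩, he, hadj⟩ a
    have h1 : G.Adj (e a) x := ((hadj _).2 ⟨a, rfl⟩).symm
    obtain ⟨e', h2, h3, h4⟩ := exists_enumeration_apply_eq hG h1 a
    exact ⟨⟨⟨e a, e'⟩, h2, h3⟩, rfl, h4⟩
  choose nxt hnxt1 hnxt2 using hstep
  obtain ⟨e₀, he₀, hadj₀⟩ := exists_enumeration hG o
  let s₀ : S := ⟨⟨o, e₀⟩, he₀, hadj₀⟩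
  let st : List (Fin d) → S := List.foldr (fun a s => nxt s a) s₀
  have key : ∀ (v : BetheVertex d) (a : Fin d), (st (betheFlip a v).1).1.1 = (st v.1).1.2 a := by
    intro v a
    by_cases h : v.1.head? = some a
    · have h1 : v.1 = a :: v.1.tail := (List.cons_head?_tail h).symm
      have h2 : (betheFlip a v).1 = v.1.tail := by simp [betheFlip, h]
      rw [h2]
      conv_rhs => rw [h1]
      exact (hnxt2 (st v.1.tail) a).symm
    · have h2 : (betheFlip a v).1 = a :: v.1 := by simp [betheFlip, h]
      rw [h2]
      exact hnxt1 (st v.1) a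
  refine ⟨fun v => (st v.1).1.1, ⟨fun v a b hab => ?_, fun v x => ?_⟩, rfl⟩
  · simp only [key] at hab
    exact (st v.1).2.1 hab
  · simp only [key]
    exact (st v.1).2.2 x

theorem IsBetheCover.map_adj {d : ℕ} {V : Type*} {G : SimpleGraph V} {φ : BetheVertex d → V}
    (hφ : IsBetheCover G φ) {v w : BetheVertex d} (h : (betheTree d).Adj v w) :
    G.Adj (φ v) (φ w) := by
  obtain ⟨a, rfl⟩ := (betheTree_adj_iff v w).1 h
  exact (hφ.adj_iff v _).2 ⟨a, rfl⟩

theorem IsBetheCover.eq_of_adj {d : ℕ} {V : Type*} {G : SimpleGraph V} {φ : BetheVertex d → V}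
    (hφ : IsBetheCover G φ) {u v w : BetheVertex d} (hv : (betheTree d).Adj u v)
    (hw : (betheTree d).Adj u w) (h : φ v = φ w) : v = w := by
  obtain ⟨a, rfl⟩ := (betheTree_adj_iff u v).1 hv
  obtain ⟨b, rfl⟩ := (betheTree_adj_iff u w).1 hw
  rw [hφ.injective u h]

/-- The edges between consecutive vertices of a list. -/
def pathEdges {V : Type*} : List V → List (Sym2 V)
  | [] => []
  | [_] => []
  | x :: y :: l => s(x, y) :: pathEdges (y :: l)

/-- The list `p` of vertices is a walk in `G` from `o` to the first entry of `p`. -/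
def IsWalkFrom {V : Type*} (G : SimpleGraph V) (o : V) (p : List V) : Prop :=
  p.getLast? = some o ∧ ∀ e ∈ pathEdges p, e ∈ G.edgeSet

/-- There are walks from `o` with `n` and `m` vertices whose endpoints are joined by an edge that
neither of them uses: near `o` the graph has a cycle. -/
def HasExcessEdge {V : Type*} (G : SimpleGraph V) (o : V) (n m : ℕ) : Prop :=
  ∃ p q : List V, p.length = n ∧ q.length = m ∧ IsWalkFrom G o p ∧ IsWalkFrom G o q ∧
    ∃ x ∈ p.head?, ∃ y ∈ q.head?, G.Adj x y ∧ s(x, y) ∉ pathEdges p ∧ s(x, y) ∉ pathEdges q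

/-- The image under `φ` of the path in the tree from a word to the root. -/
def betheTrace {d : ℕ} {V : Type*} (φ : BetheVertex d → V) :
    (l : List (Fin d)) → l.IsChain (· ≠ ·) → List V
  | [], h => [φ ⟨[], h⟩]
  | a :: l, h => φ ⟨a :: l, h⟩ :: betheTrace φ l h.of_cons

theorem length_betheTrace {d : ℕ} {V : Type*} (φ : BetheVertex d → V) (l : List (Fin d))
    (h : l.IsChain (· ≠ ·)) : (betheTrace φ l h).length = l.length + 1 := by
  induction l with
  | nil => rfl
  | cons a l ih => simp [betheTrace, ih]

theorem head?_betheTrace {d : ℕ} {V : Type*} (φ : BetheVertex d → V) (l : List (Fin d))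
    (h : l.IsChain (· ≠ ·)) : (betheTrace φ l h).head? = some (φ ⟨l, h⟩) := by
  cases l <;> rfl

theorem pathEdges_betheTrace_cons {d : ℕ} {V : Type*} (φ : BetheVertex d → V) (a : Fin d)
    (l : List (Fin d)) (h : (a :: l).IsChain (· ≠ ·)) :
    pathEdges (betheTrace φ (a :: l) h)
      = s(φ ⟨a :: l, h⟩, φ ⟨l, h.of_cons⟩) :: pathEdges (betheTrace φ l h.of_cons) := by
  cases l <;> rfl

theorem exists_of_mem_pathEdges_betheTrace {d : ℕ} {V : Type*} (φ : BetheVertex d → V)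
    (l : List (Fin d)) (h : l.IsChain (· ≠ ·)) (e : Sym2 V)
    (he : e ∈ pathEdges (betheTrace φ l h)) :
    ∃ w w' : BetheVertex d, (betheTree d).Adj w' w ∧ w'.1.length = w.1.length + 1 ∧
      w'.1.length ≤ l.length ∧ (w'.1.length = l.length → w'.1 = l) ∧ e = s(φ w', φ w) := by
  induction l with
  | nil => simp [betheTrace, pathEdges] at he
  | cons a l ih =>
    rw [pathEdges_betheTrace_cons, List.mem_cons] at he
    rcases he with rfl | he
    · exact ⟨⟨l, h.of_cons⟩, ⟨a :: l, h⟩, Or.inr ⟨a, rfl⟩, rfl, le_rfl, fun _ => rfl, rfl⟩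
    · obtain ⟨w, w', h1, h2, h3, h4, h5⟩ := ih h.of_cons he
      refine ⟨w, w', h1, h2, h3.trans (Nat.le_succ _), fun h6 => ?_, h5⟩
      rw [List.length_cons] at h6
      omega

theorem IsBetheCover.isWalkFrom_betheTrace {d : ℕ} {V : Type*} {G : SimpleGraph V}
    {φ : BetheVertex d → V} (hφ : IsBetheCover G φ) (l : List (Fin d)) (h : l.IsChain (· ≠ ·)) :
    IsWalkFrom G (φ (betheRoot d)) (betheTrace φ l h) := by
  constructor
  · induction l with
    | nil => rfl
    | cons a l ih =>
      have h1 := ih h.of_cons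
      have h2 : betheTrace φ l h.of_cons ≠ [] := by
        rw [← List.length_pos_iff, length_betheTrace]
        omega
      obtain ⟨b, l', h3⟩ := List.exists_cons_of_ne_nil h2
      rw [h3] at h1
      rw [betheTrace, h3, List.getLast?_cons_cons, h1]
  · intro e he
    obtain ⟨w, w', h1, -, -, -, rfl⟩ := exists_of_mem_pathEdges_betheTrace φ l h e he
    exact hφ.map_adj h1

/-- If a covering is injective on a ball but not on the next larger one, then two walks meet in an
edge that closes a cycle. -/
theorem IsBetheCover.injOn_succ {d : ℕ} {V : Type*} {G : SimpleGraph V}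
    {φ : BetheVertex d → V} (hφ : IsBetheCover G φ) (n : ℕ)
    (hinj : Set.InjOn φ {v | v.1.length ≤ n})
    (hG : ∀ m ≤ n + 2, ¬ HasExcessEdge G (φ (betheRoot d)) (n + 1) m) :
    Set.InjOn φ {v | v.1.length ≤ n + 1} := by
  have key : ∀ u v : BetheVertex d, u.1.length ≤ n + 1 → v.1.length ≤ u.1.length → φ u = φ v →
      u = v := by
    intro u v hu hvu huv
    by_contra hne
    rcases Nat.lt_or_ge u.1.length (n + 1) with hlt | hge
    · exact hne (hinj (show u.1.length ≤ n by omega) (show v.1.length ≤ n by omega) huv)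
    obtain ⟨_ | ⟨a, l⟩, hul⟩ := u
    · simp at hge
    have hl : l.length = n := by
      simp only [List.length_cons] at hu hge
      omega
    set u' : BetheVertex d := ⟨l, hul.of_cons⟩ with hu'
    have huu' : (betheTree d).Adj u' ⟨a :: l, hul⟩ := Or.inl ⟨a, rfl⟩
    have hu'n : u'.1.length ≤ n := hl.le
    have hv : v.1.length ≤ n + 1 := hvu.trans hu
    -- the excess edge is the last edge of the path to `u`; if a path to `u'` or `v` used it, then
    -- injectivity on the smaller ball and around single vertices would give `u = v`
    refine hG (v.1.length + 1) (by omega) ⟨betheTrace φ l hul.of_cons, betheTrace φ v.1 v.2,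
      by rw [length_betheTrace, hl], by rw [length_betheTrace], hφ.isWalkFrom_betheTrace _ _,
      hφ.isWalkFrom_betheTrace _ _, φ u', head?_betheTrace _ _ _, φ v, head?_betheTrace _ _ _,
      huv ▸ hφ.map_adj huu', fun he => ?_, fun he => ?_⟩
    · obtain ⟨w, w', h1, h2, h3, h4, h5⟩ := exists_of_mem_pathEdges_betheTrace _ _ _ _ he
      rw [hl] at h3
      rcases Sym2.eq_iff.1 h5 with ⟨h6, h7⟩ | ⟨h6, h7⟩
      · have h8 : u' = w' := hinj hu'n h3 h6
        rw [← h8] at h1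
        have h9 := hφ.eq_of_adj huu' h1 (huv.trans h7)
        have h10 := congrArg (fun x : BetheVertex d => x.1.length) h9
        simp only [List.length_cons] at h10
        omega
      · have h8 : u' = w := hinj hu'n (show w.1.length ≤ n by omega) h6
        have h10 : u'.1.length = w.1.length := by rw [h8]
        change l.length = _ at h10
        omega
    · obtain ⟨w, w', h1, h2, h3, h4, h5⟩ := exists_of_mem_pathEdges_betheTrace _ _ _ _ he
      rcases Sym2.eq_iff.1 h5 with ⟨h6, h7⟩ | ⟨h6, h7⟩
      · rcases Nat.lt_or_ge n w'.1.length with h8 | h8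
        · have h9 : w' = v := Subtype.ext (h4 (by omega))
          have h10 := hφ.map_adj huu'
          rw [huv, h6, h9] at h10
          exact G.loopless.irrefl _ h10
        · have h9 : u' = w' := hinj hu'n h8 h6
          rw [← h9] at h1
          have h9 := hφ.eq_of_adj huu' h1 (huv.trans h7)
          have h10 := congrArg (fun x : BetheVertex d => x.1.length) h9
          simp only [List.length_cons] at h10
          omega
      · have h8 : u' = w := hinj hu'n (show w.1.length ≤ n by omega) h6
        rw [← h8] at h1
        have h9 := hφ.eq_of_adj huu' h1.symm (huv.trans h7)
        have h10 := congrArg (fun x : BetheVertex d => x.1.length) h9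
        simp only [List.length_cons] at h10
        exact hne (h9.trans (Subtype.ext (h4 (by omega))))
  intro u hu v hv huv
  rcases le_total v.1.length u.1.length with h | h
  · exact key u v hu h huv
  · exact (key v u hv h huv.symm).symm

theorem IsBetheCover.injOn_ball {d : ℕ} {V : Type*} {G : SimpleGraph V}
    {φ : BetheVertex d → V} (hφ : IsBetheCover G φ) (r : ℕ)
    (hG : ∀ n ≤ r, ∀ m ≤ n + 1, ¬ HasExcessEdge G (φ (betheRoot d)) n m) :
    Set.InjOn φ {v | v.1.length ≤ r} := by
  induction r with
  | zero =>
    intro u hu v hv _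
    have h1 : u.1 = [] := List.length_eq_zero_iff.1 (Nat.le_zero.1 hu)
    have h2 : v.1 = [] := List.length_eq_zero_iff.1 (Nat.le_zero.1 hv)
    exact Subtype.ext (h1.trans h2.symm)
  | succ r ih =>
    exact hφ.injOn_succ r (ih fun n hn => hG n (hn.trans (Nat.le_succ r))) (hG (r + 1) le_rfl)

/-! ### Switchings and short cycles in random regular graphs -/

/-- The switching that replaces the edges `uv` and `xy` of `G` by `ux` and `vy`. -/
def switchGraph {V : Type*} (G : SimpleGraph V) (u v x y : V) : SimpleGraph V where
  Adj a b := a ≠ b ∧ ((G.Adj a b ∧ s(a, b) ≠ s(u, v) ∧ s(a, b) ≠ s(x, y)) ∨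
    s(a, b) = s(u, x) ∨ s(a, b) = s(v, y))
  symm := ⟨fun a b h => by
    rw [Sym2.eq_swap (a := b) (b := a), G.adj_comm b a]
    exact ⟨h.1.symm, h.2⟩⟩
  loopless := ⟨fun _ h => h.1 rfl⟩

/-- The switching of `uv` and `xy` is admissible: it keeps the graph simple and changes exactly
these two edges. -/
structure IsSwitchable {V : Type*} (G : SimpleGraph V) (u v x y : V) : Prop where
  adj_uv : G.Adj u v
  adj_xy : G.Adj x y
  ne_ux : u ≠ x
  ne_vy : v ≠ y
  not_adj_ux : ¬ G.Adj u x
  not_adj_vy : ¬ G.Adj v y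

/-- A switching exchanges one neighbour for another at each of the four vertices. -/
theorem IsSwitchable.exists_perm {V : Type*} [DecidableEq V] {G : SimpleGraph V} {u v x y : V}
    (h : IsSwitchable G u v x y) (a : V) :
    ∃ σ : Equiv.Perm V, ∀ b, (switchGraph G u v x y).Adj a b ↔ G.Adj a (σ b) := by
  obtain ⟨h1, h2, h3, h4, h5, h6⟩ := h
  have huv := h1.ne
  have hxy := h2.ne
  have hvx : v ≠ x := fun h => h5 (h ▸ h1)
  have huy : u ≠ y := fun h => h6 (h ▸ h1.symm)
  have e1 := h1.symm
  have e2 := h2.symm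
  have e3 : ¬ G.Adj x u := fun h => h5 h.symm
  have e4 : ¬ G.Adj y v := fun h => h6 h.symm
  have hl := G.loopless.irrefl
  by_cases hau : a = u
  · refine ⟨Equiv.swap v x, fun b => ?_⟩
    simp only [switchGraph, Sym2.eq_iff, Equiv.swap_apply_def]
    split_ifs <;> grind
  by_cases hav : a = v
  · refine ⟨Equiv.swap u y, fun b => ?_⟩
    simp only [switchGraph, Sym2.eq_iff, Equiv.swap_apply_def]
    split_ifs <;> grind
  by_cases hax : a = x
  · refine ⟨Equiv.swap y u, fun b => ?_⟩
    simp only [switchGraph, Sym2.eq_iff, Equiv.swap_apply_def]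
    split_ifs <;> grind
  by_cases hay : a = y
  · refine ⟨Equiv.swap x v, fun b => ?_⟩
    simp only [switchGraph, Sym2.eq_iff, Equiv.swap_apply_def]
    split_ifs <;> grind
  · refine ⟨1, fun b => ?_⟩
    simp only [switchGraph, Sym2.eq_iff, Equiv.Perm.coe_one, id]
    grind

theorem IsSwitchable.ncard_neighborSet {V : Type*} {G : SimpleGraph V} {u v x y : V}
    (h : IsSwitchable G u v x y) (a : V) :
    ((switchGraph G u v x y).neighborSet a).ncard = (G.neighborSet a).ncard := by
  classical
  obtain ⟨σ, hσ⟩ := h.exists_perm a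
  rw [← Set.ncard_image_of_injective _ σ.injective]
  congr 1
  ext b
  simp only [Set.mem_image, SimpleGraph.mem_neighborSet, hσ]
  exact ⟨fun ⟨c, hc, hcb⟩ => hcb ▸ hc, fun hb => ⟨σ.symm b, by simpa using hb, by simp⟩⟩

/-- The original graph can be recovered from the switched one. -/
theorem IsSwitchable.eq_of_switchGraph_eq {V : Type*} {G G' : SimpleGraph V} {u v x y : V}
    (h : IsSwitchable G u v x y) (h' : IsSwitchable G' u v x y)
    (heq : switchGraph G u v x y = switchGraph G' u v x y) : G = G' := by
  have key : ∀ {H : SimpleGraph V}, IsSwitchable H u v x y → ∀ a b, H.Adj a b ↔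
      ((switchGraph H u v x y).Adj a b ∧ s(a, b) ≠ s(u, x) ∧ s(a, b) ≠ s(v, y)) ∨
        s(a, b) = s(u, v) ∨ s(a, b) = s(x, y) := by
    intro H ⟨h1, h2, h3, h4, h5, h6⟩ a b
    have e1 : s(a, b) = s(u, v) → H.Adj a b := fun h => by
      rwa [← SimpleGraph.mem_edgeSet, h]
    have e2 : s(a, b) = s(x, y) → H.Adj a b := fun h => by
      rwa [← SimpleGraph.mem_edgeSet, h]
    have e3 : s(a, b) = s(u, x) → ¬ H.Adj a b := fun h => by
      rwa [← SimpleGraph.mem_edgeSet, h]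
    have e4 : s(a, b) = s(v, y) → ¬ H.Adj a b := fun h => by
      rwa [← SimpleGraph.mem_edgeSet, h]
    have hl : H.Adj a b → a ≠ b := SimpleGraph.Adj.ne
    change _ ↔ ((a ≠ b ∧ ((H.Adj a b ∧ s(a, b) ≠ s(u, v) ∧ s(a, b) ≠ s(x, y)) ∨
      s(a, b) = s(u, x) ∨ s(a, b) = s(v, y))) ∧ _) ∨ _
    tauto
  ext a b
  rw [key h, key h', heq]

theorem IsWalkFrom.switchGraph {V : Type*} {G : SimpleGraph V} {o u v x y : V} {p : List V}
    (hp : IsWalkFrom G o p) (h1 : s(u, v) ∉ pathEdges p) (h2 : s(x, y) ∉ pathEdges p) :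
    IsWalkFrom (switchGraph G u v x y) o p := by
  refine ⟨hp.1, fun e he => ?_⟩
  have h3 := hp.2 e he
  induction e using Sym2.ind with
  | _ a b =>
    exact ⟨SimpleGraph.Adj.ne h3, Or.inl ⟨h3, fun h => h1 (h ▸ he), fun h => h2 (h ▸ he)⟩⟩

theorem length_pathEdges_le {V : Type*} (p : List V) : (pathEdges p).length ≤ p.length := by
  induction p with
  | nil => simp [pathEdges]
  | cons a p ih =>
    cases p with
    | nil => simp [pathEdges]
    | cons b p => simpa [pathEdges] using ih

theorem card_filter_adj {V : Type*} [Fintype V] {d : ℕ} {G : SimpleGraph V}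
    [DecidableRel G.Adj] (hG : ∀ a, (G.neighborSet a).ncard = d) (a : V) :
    (Finset.univ.filter (G.Adj a)).card = d := by
  rw [← hG a, Set.ncard_eq_toFinset_card']
  congr 1
  ext b
  simp

open Classical in
/-- Almost all edges of a regular graph can be switched with a given edge. -/
theorem card_le_card_switchable {V : Type*} [Fintype V] {d : ℕ} {G : SimpleGraph V}
    (hG : ∀ a, (G.neighborSet a).ncard = d) {u v : V} (huv : G.Adj u v) (E : List (Sym2 V)) :
    Fintype.card V * d ≤ (Finset.univ.filter fun w : V × V =>
      IsSwitchable G u v w.1 w.2 ∧ s(w.1, w.2) ∉ E).card + (2 * (d * (d + 1)) + 2 * E.length) := by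
  have htot : (Finset.univ.filter fun w : V × V => G.Adj w.1 w.2).card = Fintype.card V * d := by
    rw [Finset.card_filter, Fintype.sum_prod_type]
    simp only [← Finset.card_filter]
    simp [card_filter_adj hG]
  have hins : ∀ a, (insert a (Finset.univ.filter (G.Adj a))).card ≤ d + 1 := fun a =>
    (Finset.card_insert_le _ _).trans (by rw [card_filter_adj hG])
  set A := (insert u (Finset.univ.filter (G.Adj u))).biUnion fun x =>
    (Finset.univ.filter (G.Adj x)).image fun y => (x, y) with hA
  set B := (insert v (Finset.univ.filter (G.Adj v))).biUnion fun y =>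
    (Finset.univ.filter (G.Adj y)).image fun x => (x, y) with hB
  set C := E.toFinset.biUnion fun e => Finset.univ.filter fun w : V × V => s(w.1, w.2) = e with hC
  have hAc : A.card ≤ d * (d + 1) := by
    refine (Finset.card_biUnion_le_card_mul _ _ d fun x _ =>
      Finset.card_image_le.trans (card_filter_adj hG x).le).trans ?_
    rw [mul_comm]
    exact Nat.mul_le_mul_left _ (hins u)
  have hBc : B.card ≤ d * (d + 1) := by
    refine (Finset.card_biUnion_le_card_mul _ _ d fun x _ =>
      Finset.card_image_le.trans (card_filter_adj hG x).le).trans ?_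
    rw [mul_comm]
    exact Nat.mul_le_mul_left _ (hins v)
  have hCc : C.card ≤ 2 * E.length := by
    refine (Finset.card_biUnion_le_card_mul _ _ 2 fun e _ => ?_).trans ?_
    · induction e using Sym2.ind with
      | _ a b =>
        refine (Finset.card_le_card (t := {(a, b), (b, a)}) ?_).trans Finset.card_le_two
        rintro ⟨x, y⟩ hw
        simpa [Sym2.eq_iff] using hw
    · rw [mul_comm]
      exact Nat.mul_le_mul_left _ (List.toFinset_card_le E)
  rw [← htot]
  refine (Finset.card_le_card (t := (Finset.univ.filter fun w : V × V =>
      IsSwitchable G u v w.1 w.2 ∧ s(w.1, w.2) ∉ E) ∪ (A ∪ (B ∪ C))) ?_).trans ?_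
  · rintro ⟨x, y⟩ hw
    have hxy : G.Adj x y := by simpa using hw
    simp only [Finset.mem_union, Finset.mem_filter, Finset.mem_univ, true_and, hA, hB, hC,
      Finset.mem_biUnion, Finset.mem_insert, Finset.mem_image, List.mem_toFinset, Prod.mk.injEq]
    by_cases h1 : x = u ∨ G.Adj u x
    · exact Or.inr (Or.inl ⟨x, h1, y, hxy, rfl, rfl⟩)
    by_cases h2 : y = v ∨ G.Adj v y
    · exact Or.inr (Or.inr (Or.inl ⟨y, h2, x, hxy.symm, rfl, rfl⟩))
    by_cases h3 : s(x, y) ∈ E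
    · exact Or.inr (Or.inr (Or.inr ⟨_, h3, rfl⟩))
    push Not at h1 h2
    exact Or.inl ⟨⟨huv, hxy, h1.1.symm, h2.1.symm, h1.2, h2.2⟩, h3⟩
  · have h1 := Finset.card_union_le (Finset.univ.filter fun w : V × V =>
      IsSwitchable G u v w.1 w.2 ∧ s(w.1, w.2) ∉ E) (A ∪ (B ∪ C))
    have h2 := Finset.card_union_le A (B ∪ C)
    have h3 := Finset.card_union_le B C
    omega

open Classical in
/-- Switching away an edge `uv` not used by the walks `p` and `q` shows that few regular graphs
containing `p` and `q` contain this edge. -/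
theorem card_excess_mul_le {V : Type*} [Fintype V] [Fintype (SimpleGraph V)] (d : ℕ) (o u v : V)
    (p q : List V) :
    (Finset.univ.filter fun G : SimpleGraph V => (∀ a, (G.neighborSet a).ncard = d) ∧
        IsWalkFrom G o p ∧ IsWalkFrom G o q ∧
        (G.Adj u v ∧ s(u, v) ∉ pathEdges p ∧ s(u, v) ∉ pathEdges q)).card * (Fintype.card V * d)
      ≤ (Finset.univ.filter fun G : SimpleGraph V => (∀ a, (G.neighborSet a).ncard = d) ∧
          IsWalkFrom G o p ∧ IsWalkFrom G o q).card * (d * d)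
        + (Finset.univ.filter fun G : SimpleGraph V => (∀ a, (G.neighborSet a).ncard = d) ∧
        IsWalkFrom G o p ∧ IsWalkFrom G o q ∧
        (G.Adj u v ∧ s(u, v) ∉ pathEdges p ∧ s(u, v) ∉ pathEdges q)).card
          * (2 * (d * (d + 1)) + 2 * (p.length + q.length)) := by
  set A := Finset.univ.filter fun G : SimpleGraph V => (∀ a, (G.neighborSet a).ncard = d) ∧
        IsWalkFrom G o p ∧ IsWalkFrom G o q ∧
        (G.Adj u v ∧ s(u, v) ∉ pathEdges p ∧ s(u, v) ∉ pathEdges q) with hA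
  set B := Finset.univ.filter fun G : SimpleGraph V => (∀ a, (G.neighborSet a).ncard = d) ∧
          IsWalkFrom G o p ∧ IsWalkFrom G o q with hB
  set E := pathEdges p ++ pathEdges q with hE
  have hEl : E.length ≤ p.length + q.length := by
    rw [hE, List.length_append]
    exact Nat.add_le_add (length_pathEdges_le p) (length_pathEdges_le q)
  let D : SimpleGraph V → Finset (V × V) := fun G => Finset.univ.filter fun w : V × V =>
      IsSwitchable G u v w.1 w.2 ∧ s(w.1, w.2) ∉ E
  let T : SimpleGraph V → Finset (V × V) := fun G =>
    Finset.univ.filter (G.Adj u) ×ˢ Finset.univ.filter (G.Adj v)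
  -- the switched graph remembers `(x, y)` as a pair of neighbours of `u` and `v`
  have h1 : (A.sigma D).card ≤ (B.sigma T).card := by
    refine Finset.card_le_card_of_injOn
      (fun w => ⟨switchGraph w.1 u v w.2.1 w.2.2, w.2⟩) ?_ ?_
    · rintro ⟨G, x, y⟩ hw
      simp only [Finset.mem_coe, Finset.mem_sigma, hA, D, Finset.mem_filter, Finset.mem_univ,
        true_and, hE, List.mem_append, not_or] at hw
      obtain ⟨⟨h1, h2, h3, h4, h5, h6⟩, h7, h8, h9⟩ := hw
      simp only [Finset.mem_coe, Finset.mem_sigma, hB, T, Finset.mem_filter, Finset.mem_univ,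
        true_and, Finset.mem_product]
      refine ⟨⟨fun a => (h7.ncard_neighborSet a).trans (h1 a), h2.switchGraph h5 h8,
        h3.switchGraph h6 h9⟩, ⟨h7.ne_ux, Or.inr (Or.inl rfl)⟩, h7.ne_vy, Or.inr (Or.inr rfl)⟩
    · rintro ⟨G, x, y⟩ hw ⟨G', x', y'⟩ hw' heq
      simp only [Finset.mem_coe, Finset.mem_sigma, D, Finset.mem_filter, Finset.mem_univ,
        true_and] at hw hw'
      simp only [Sigma.mk.injEq, heq_eq_eq, Prod.mk.injEq] at heq
      obtain ⟨h1, rfl, rfl⟩ := heq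
      rw [hw.2.1.eq_of_switchGraph_eq hw'.2.1 h1]
  have h2 : (B.sigma T).card = B.card * (d * d) := by
    rw [Finset.card_sigma, Finset.sum_const_nat]
    intro G hG
    have hG' : ∀ a, (G.neighborSet a).ncard = d := (Finset.mem_filter.1 hG).2.1
    rw [Finset.card_product, card_filter_adj hG', card_filter_adj hG']
  have h3 : A.card * (Fintype.card V * d)
      ≤ (A.sigma D).card + A.card * (2 * (d * (d + 1)) + 2 * (p.length + q.length)) := by
    rw [Finset.card_sigma, ← smul_eq_mul A.card, ← smul_eq_mul A.card, ← Finset.sum_const,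
      ← Finset.sum_const, ← Finset.sum_add_distrib]
    refine Finset.sum_le_sum fun G hG => ?_
    obtain ⟨hG1, -, -, hG2, -⟩ := (Finset.mem_filter.1 hG).2
    have := card_le_card_switchable hG1 hG2 E
    refine this.trans (Nat.add_le_add_left ?_ _)
    omega
  omega

open Classical in
theorem card_walks_le {V : Type*} [Finite V] {d : ℕ} (hd : 1 ≤ d) {G : SimpleGraph V}
    (hG : ∀ a, (G.neighborSet a).ncard = d) (o : V) (n : ℕ) :
    ((List.finite_length_eq V n).toFinset.filter (IsWalkFrom G o)).card ≤ d ^ n := by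
  have := Fintype.ofFinite V
  induction n with
  | zero =>
    rw [Finset.filter_false_of_mem]
    · simp
    · intro p hp
      have : p = [] := by simpa using hp
      subst this
      simp [IsWalkFrom]
  | succ n ih =>
    rcases n with _ | n
    · refine (Finset.card_le_card (t := {[o]}) ?_).trans (by simpa using hd)
      intro p hp
      simp only [Finset.mem_filter, Set.Finite.mem_toFinset, Set.mem_ofPred_eq] at hp
      obtain ⟨a, rfl⟩ := List.length_eq_one_iff.1 hp.1
      have := hp.2.1
      simpa using this
    · rw [pow_succ]
      refine le_trans (Finset.card_le_card (t := ((List.finite_length_eq V (n + 1)).toFinset.filter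
        (IsWalkFrom G o)).biUnion fun q => (Finset.univ.filter fun x =>
          ∃ y ∈ q.head?, G.Adj y x).image fun x => x :: q) ?_)
        ((Finset.card_biUnion_le_card_mul _ _ d fun q _ => ?_).trans (Nat.mul_le_mul_right _ ih))
      · intro p hp
        simp only [Finset.mem_filter, Set.Finite.mem_toFinset, Set.mem_ofPred_eq] at hp
        obtain ⟨hpl, hp1, hp2⟩ := hp
        rcases p with _ | ⟨x, _ | ⟨y, l⟩⟩
        · simp at hpl
        · simp at hpl
        · simp only [Finset.mem_biUnion, Finset.mem_filter, Set.Finite.mem_toFinset,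
            Set.mem_ofPred_eq, Finset.mem_image, Finset.mem_univ, true_and]
          refine ⟨y :: l, ⟨by simpa using hpl, by simpa using hp1, fun e he => hp2 e ?_⟩, x,
            ⟨y, rfl, ?_⟩, rfl⟩
          · exact List.mem_cons_of_mem _ he
          · exact SimpleGraph.Adj.symm (hp2 s(x, y) List.mem_cons_self)
      · refine Finset.card_image_le.trans ?_
        rcases q with _ | ⟨y, l⟩
        · simp
        · rw [← card_filter_adj hG y]
          refine Finset.card_le_card fun x hx => ?_
          simpa using hx

open Classical in
/-- The number of regular graphs with an excess edge near `o` is smaller than the number of all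
regular graphs by a factor of the order of the number of vertices. -/
theorem card_hasExcessEdge_mul_le {V : Type*} [Fintype V] [Fintype (SimpleGraph V)] {d : ℕ}
    (hd : 1 ≤ d) (o : V) (n m : ℕ) :
    (Finset.univ.filter fun G : SimpleGraph V => (∀ a, (G.neighborSet a).ncard = d) ∧
        HasExcessEdge G o n m).card * Fintype.card V
      ≤ d ^ (n + m) * (d * d + (2 * (d * (d + 1)) + 2 * (n + m))) *
        (Finset.univ.filter fun G : SimpleGraph V => ∀ a, (G.neighborSet a).ncard = d).card := by
  set X := Finset.univ.filter fun G : SimpleGraph V => ∀ a, (G.neighborSet a).ncard = d with hX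
  set C := 2 * (d * (d + 1)) + 2 * (n + m) with hC
  set P := (List.finite_length_eq V n).toFinset ×ˢ (List.finite_length_eq V m).toFinset with hP
  let A : List V × List V → Finset (SimpleGraph V) := fun w => X.filter fun G =>
    IsWalkFrom G o w.1 ∧ IsWalkFrom G o w.2 ∧ ∃ x ∈ w.1.head?, ∃ y ∈ w.2.head?,
      G.Adj x y ∧ s(x, y) ∉ pathEdges w.1 ∧ s(x, y) ∉ pathEdges w.2
  let B : List V × List V → Finset (SimpleGraph V) := fun w => X.filter fun G =>
    IsWalkFrom G o w.1 ∧ IsWalkFrom G o w.2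
  have h1 : (Finset.univ.filter fun G : SimpleGraph V => (∀ a, (G.neighborSet a).ncard = d) ∧
      HasExcessEdge G o n m).card ≤ ∑ w ∈ P, (A w).card := by
    refine (Finset.card_le_card ?_).trans Finset.card_biUnion_le
    intro G hG
    obtain ⟨hG1, p, q, hp, hq, hG2⟩ := (Finset.mem_filter.1 hG).2
    refine Finset.mem_biUnion.2 ⟨(p, q), ?_, ?_⟩
    · simp [hP, hp, hq]
    · exact Finset.mem_filter.2 ⟨Finset.mem_filter.2 ⟨Finset.mem_univ _, hG1⟩, hG2⟩
  have hAB : ∀ w, (A w).card ≤ (B w).card := fun w =>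
    Finset.card_le_card (Finset.monotone_filter_right _ fun G _ hG => ⟨hG.1, hG.2.1⟩)
  have h2 : ∀ w ∈ P, (A w).card * (Fintype.card V * d) ≤ (B w).card * (d * d + C) := by
    rintro ⟨p, q⟩ hw
    have hp : p.length = n := by simpa using (Finset.mem_product.1 hw).1
    have hq : q.length = m := by simpa using (Finset.mem_product.1 hw).2
    rcases p with _ | ⟨u, p⟩
    · simp [A]
    rcases q with _ | ⟨v, q⟩
    · simp [A]
    have h3 := card_excess_mul_le d o u v (u :: p) (v :: q)
    have h4 := Nat.mul_le_mul_right C (hAB (u :: p, v :: q))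
    rw [hp, hq] at h3
    simp only [A, B, hX, Finset.filter_filter, List.head?_cons, Option.mem_def,
      Option.some.injEq, exists_eq_left'] at h4 ⊢
    rw [mul_add]
    exact h3.trans (Nat.add_le_add_left h4 _)
  have h3 : ∑ w ∈ P, (B w).card ≤ X.card * d ^ (n + m) := by
    have h4 : ∑ w ∈ P, (B w).card = ∑ G ∈ X, (P.filter fun w : List V × List V =>
        IsWalkFrom G o w.1 ∧ IsWalkFrom G o w.2).card := by
      simp only [B, Finset.card_filter]
      exact Finset.sum_comm
    rw [h4, ← smul_eq_mul, ← Finset.sum_const]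
    refine Finset.sum_le_sum fun G hG => ?_
    have hG' : ∀ a, (G.neighborSet a).ncard = d := (Finset.mem_filter.1 hG).2
    have h5 : (P.filter fun w : List V × List V => IsWalkFrom G o w.1 ∧ IsWalkFrom G o w.2)
        = (List.finite_length_eq V n).toFinset.filter (IsWalkFrom G o) ×ˢ
          (List.finite_length_eq V m).toFinset.filter (IsWalkFrom G o) := by
      ext ⟨p, q⟩
      simp only [hP, Finset.mem_filter, Finset.mem_product]
      tauto
    rw [h5, Finset.card_product, pow_add]
    exact Nat.mul_le_mul (card_walks_le hd hG' o n) (card_walks_le hd hG' o m)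
  have h4 : (∑ w ∈ P, (A w).card) * (Fintype.card V * d)
      ≤ X.card * d ^ (n + m) * (d * d + C) := by
    rw [Finset.sum_mul]
    refine (Finset.sum_le_sum h2).trans ?_
    rw [← Finset.sum_mul]
    exact Nat.mul_le_mul_right _ h3
  calc _ ≤ (∑ w ∈ P, (A w).card) * (Fintype.card V * d) :=
        Nat.mul_le_mul h1 (Nat.le_mul_of_pos_right _ hd)
    _ ≤ _ := h4
    _ = _ := by ring

theorem uniformRegularGraph_eq {d N : ℕ} :
    uniformRegularGraph d N
      = uniformOn {G : SimpleGraph (Fin N) | ∀ a, (G.neighborSet a).ncard = d} := by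
  unfold uniformRegularGraph
  congr 1
  ext G
  exact @isRegularOfDegree_iff_ncard _ G _ d

instance (N : ℕ) : DiscreteMeasurableSpace (SimpleGraph (Fin N)) := ⟨fun _ => trivial⟩

/-- The first vertex of a random regular graph rarely has an excess edge nearby. -/
theorem uniformRegularGraph_hasExcessEdge_le {d : ℕ} (hd : 1 ≤ d) (n m : ℕ) :
    ∃ K : ℕ, ∀ (N : ℕ) (o : Fin N), uniformRegularGraph d N {G | HasExcessEdge G o n m} ≤
      (K : ENNReal) / N := by
  classical
  refine ⟨d ^ (n + m) * (d * d + (2 * (d * (d + 1)) + 2 * (n + m))), fun N o => ?_⟩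
  have := Fintype.ofFinite (SimpleGraph (Fin N))
  have h1 := card_hasExcessEdge_mul_le hd o n m
  set K := d ^ (n + m) * (d * d + (2 * (d * (d + 1)) + 2 * (n + m)))
  rw [uniformRegularGraph_eq, uniformOn, cond_apply (Set.toFinite _).measurableSet]
  set X : Set (SimpleGraph (Fin N)) := {G | ∀ a, (G.neighborSet a).ncard = d} with hX
  have hcard : ∀ s : Set (SimpleGraph (Fin N)), s.ncard = (Finset.univ.filter (· ∈ s)).card := by
    intro s
    rw [← Set.ncard_coe_finset]
    simp
  have hcount : ∀ s : Set (SimpleGraph (Fin N)), Measure.count s = (s.ncard : ENNReal) := by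
    intro s
    rw [hcard, ← Measure.count_apply_finset]
    simp
  have h2 : (X ∩ {G | HasExcessEdge G o n m}).ncard * N ≤ K * X.ncard := by
    rw [hcard, hcard]
    convert h1 using 3
    · ext G
      simp [hX]
    · simp
    · ext G
      simp [hX]
  rw [hcount, hcount]
  generalize (X ∩ {G | HasExcessEdge G o n m}).ncard = a at h2 ⊢
  generalize X.ncard = b at h2 ⊢
  have hN : 0 < N := o.pos
  rcases Nat.eq_zero_or_pos b with hb0 | hb0
  · have : a = 0 := by
      rw [hb0, mul_zero] at h2
      exact (Nat.mul_eq_zero.1 (Nat.le_zero.1 h2)).resolve_right hN.ne'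
    rw [this]
    simp
  · rw [ENNReal.le_div_iff_mul_le (by simp [hN.ne']) (by simp), mul_assoc, mul_comm,
      ← div_eq_mul_inv, ENNReal.div_le_iff_le_mul (by simp [hb0.ne']) (by simp)]
    exact_mod_cast h2

/-! ### Existence of regular graphs -/

theorem exists_regular_of_symmetric {Γ : Type*} [AddCommGroup Γ] (S : Finset Γ)
    (h0 : (0 : Γ) ∉ S) (hS : ∀ x ∈ S, -x ∈ S) :
    ∃ G : SimpleGraph Γ, ∀ a, (G.neighborSet a).ncard = S.card := by
  refine ⟨{ Adj := fun a b => b - a ∈ S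
            symm := ⟨fun a b h => by simpa using hS _ h⟩
            loopless := ⟨fun a h => h0 (by simpa using h)⟩ }, fun a => ?_⟩
  rw [← Set.ncard_coe_finset, ← Set.ncard_image_of_injective (S : Set Γ) (add_right_injective a)]
  congr 1
  ext b
  simp only [SimpleGraph.mem_neighborSet, Set.mem_image, Finset.mem_coe]
  exact ⟨fun h => ⟨b - a, h, by abel⟩, by rintro ⟨c, hc, rfl⟩; simpa using hc⟩

/-- There is a `d`-regular graph on `N` vertices as soon as `d < N` and `N d` is even, namely a
circulant graph. -/
theorem exists_regular {d N : ℕ} (hdN : d + 1 ≤ N) (heven : Even (N * d)) :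
    ∃ G : SimpleGraph (Fin N), ∀ a, (G.neighborSet a).ncard = d := by
  have : NeZero N := ⟨by omega⟩
  suffices h : ∃ T : Finset ℕ, T.card = d ∧ ∀ x ∈ T, 0 < x ∧ x < N ∧ N - x ∈ T by
    obtain ⟨T, hTd, hT⟩ := h
    have hlt : ∀ x ∈ T, x < N := fun x hx => (hT x hx).2.1
    have h1 := exists_regular_of_symmetric (Γ := Fin N) (T.attachFin hlt) (fun h => ?_)
      (fun x hx => ?_)
    · rwa [Finset.card_attachFin, hTd] at h1
    · rw [Finset.mem_attachFin] at h
      exact absurd (hT _ h).1 (by simp)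
    · rw [Finset.mem_attachFin] at hx ⊢
      obtain ⟨h2, h3, h4⟩ := hT _ hx
      rwa [Fin.val_neg', Nat.mod_eq_of_lt (by omega)]
  obtain ⟨k, hk⟩ := Nat.even_or_odd' d
  have hdisj : Disjoint (Finset.Icc 1 k) (Finset.Icc (N - k) (N - 1)) := by
    rw [Finset.disjoint_left]
    intro x hx hx'
    simp only [Finset.mem_Icc] at hx hx'
    omega
  rcases hk with hk | hk
  · refine ⟨Finset.Icc 1 k ∪ Finset.Icc (N - k) (N - 1), ?_, fun x hx => ?_⟩
    · rw [Finset.card_union_of_disjoint hdisj, Nat.card_Icc, Nat.card_Icc]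
      omega
    · simp only [Finset.mem_union, Finset.mem_Icc] at hx ⊢
      omega
  · have hN : Even N := by
      rcases Nat.even_mul.1 heven with h | h
      · exact h
      · exact absurd h (by rw [hk]; simp)
    obtain ⟨M, hM⟩ := hN
    refine ⟨insert M (Finset.Icc 1 k ∪ Finset.Icc (N - k) (N - 1)), ?_, fun x hx => ?_⟩
    · rw [Finset.card_insert_of_notMem, Finset.card_union_of_disjoint hdisj, Nat.card_Icc,
        Nat.card_Icc]
      · omega
      · simp only [Finset.mem_union, Finset.mem_Icc]
        omega
    · simp only [Finset.mem_insert, Finset.mem_union, Finset.mem_Icc] at hx ⊢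
      omega

theorem isProbabilityMeasure_uniformRegularGraph {d N : ℕ} (hdN : d + 1 ≤ N)
    (heven : Even (N * d)) : IsProbabilityMeasure (uniformRegularGraph d N) := by
  rw [uniformRegularGraph_eq]
  exact isProbabilityMeasure_uniformOn (Set.toFinite _) (exists_regular hdN heven)

/-! ### Labelling the vertices of a graph by vertices of the tree -/

theorem finite_betheBall (d r : ℕ) : {v : BetheVertex d | v.1.length ≤ r}.Finite :=
  (List.finite_length_le (Fin d) r).preimage Subtype.val_injective.injOn

theorem infinite_betheVertex {d : ℕ} (hd : 2 ≤ d) : Infinite (BetheVertex d) := by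
  refine Infinite.of_surjective (fun v : BetheVertex d => v.1.length) fun n => ?_
  induction n with
  | zero => exact ⟨betheRoot d, rfl⟩
  | succ n ih =>
    obtain ⟨v, hv⟩ := ih
    have : Nontrivial (Fin d) := Fin.nontrivial_iff_two_le.2 hd
    obtain ⟨a, ha⟩ : ∃ a, ∀ b ∈ v.1.head?, a ≠ b := by
      rcases h : v.1.head? with _ | b
      · exact ⟨⟨0, by omega⟩, by simp⟩
      · obtain ⟨a, ha⟩ := exists_ne b
        exact ⟨a, by simpa using ha⟩
    exact ⟨⟨a :: v.1, List.isChain_cons.2 ⟨ha, v.2⟩⟩, by simpa using hv⟩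

/-- A map that is injective on a finite set has an inverse there that extends to an injection, if
the domain is infinite. -/
theorem exists_injective_leftInvOn {α β : Type*} [Infinite α] [Finite β] {φ : α → β} {S : Set α}
    (hS : S.Finite) (hφ : Set.InjOn φ S) :
    ∃ σ : β → α, Function.Injective σ ∧ ∀ v ∈ S, σ (φ v) = v := by
  classical
  have : Infinite ↑Sᶜ := hS.infinite_compl.to_subtype
  obtain ⟨e⟩ : Nonempty (β ↪ ↑Sᶜ) := by
    obtain ⟨n, ⟨f⟩⟩ := Finite.exists_equiv_fin β
    exact ⟨f.toEmbedding.trans (Fin.valEmbedding.trans (Infinite.natEmbedding _))⟩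
  have : Nonempty α := inferInstance
  refine ⟨fun x => if x ∈ φ '' S then Function.invFunOn φ S x else e x, fun x y hxy => ?_,
    fun v hv => ?_⟩
  · simp only at hxy
    split_ifs at hxy with hx hy hy
    · rw [← Function.invFunOn_eq hx, ← Function.invFunOn_eq hy, hxy]
    · exact absurd (hxy ▸ Function.invFunOn_mem hx) (e y).2
    · exact absurd (hxy ▸ Function.invFunOn_mem hy) (e x).2
    · exact e.injective (Subtype.ext hxy)
  · simp only
    rw [if_pos ⟨v, hv, rfl⟩]
    exact hφ (Function.invFunOn_mem ⟨v, hv, rfl⟩) hv (Function.invFunOn_eq ⟨v, hv, rfl⟩)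

/-- The graph `G` has no excess edge within distance `r` of `o`. This makes coverings based at `o`
injective on the ball of radius `r`. -/
def IsTreeLikeAt {V : Type*} (G : SimpleGraph V) (o : V) (r : ℕ) : Prop :=
  ∀ n ≤ r, ∀ m ≤ n + 1, ¬ HasExcessEdge G o n m

theorem IsTreeLikeAt.mono {V : Type*} {G : SimpleGraph V} {o : V} {r s : ℕ}
    (h : IsTreeLikeAt G o s) (hrs : r ≤ s) : IsTreeLikeAt G o r :=
  fun n hn => h n (hn.trans hrs)

/-- The labelling `σ` identifies the ball of radius `r` around `o` with the ball around the root
of the tree. -/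
def IsBallLabelling {d : ℕ} {V : Type*} (G : SimpleGraph V) (o : V) (σ : V → BetheVertex d)
    (r : ℕ) : Prop :=
  ∃ φ : BetheVertex d → V, IsBetheCover G φ ∧ φ (betheRoot d) = o ∧
    Set.InjOn φ {v | v.1.length ≤ r} ∧ ∀ v : BetheVertex d, v.1.length ≤ r → σ (φ v) = v

/-- One injective labelling serves all radii up to `N` at which the graph looks like a tree. -/
theorem exists_labelling {d : ℕ} (hd : 2 ≤ d) {V : Type*} [Finite V] (N : ℕ)
    (G : SimpleGraph V) (o : V) :
    ∃ σ : V → BetheVertex d, Function.Injective σ ∧ ((∀ a, (G.neighborSet a).ncard = d) →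
      ∀ r ≤ N, IsTreeLikeAt G o r → IsBallLabelling G o σ r) := by
  classical
  have := infinite_betheVertex hd
  by_cases hG : ∀ a, (G.neighborSet a).ncard = d
  · obtain ⟨φ, hφ, rfl⟩ := exists_isBetheCover hG o
    set s := Nat.findGreatest (fun r => Set.InjOn φ {v | v.1.length ≤ r}) N with hs
    have h0 : Set.InjOn φ {v | v.1.length ≤ 0} :=
      hφ.injOn_ball 0 fun n hn m _ ⟨p, _, hp, _, hw, _⟩ => by
        obtain rfl := List.length_eq_zero_iff.1 (hp.trans (Nat.le_zero.1 hn))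
        simpa using hw.1
    have hinj : Set.InjOn φ {v | v.1.length ≤ s} :=
      Nat.findGreatest_spec (P := fun r => Set.InjOn φ {v | v.1.length ≤ r}) (Nat.zero_le N) h0
    obtain ⟨σ, hσ, hσφ⟩ := exists_injective_leftInvOn (finite_betheBall d s) hinj
    refine ⟨σ, hσ, fun _ r hr hT => ⟨φ, hφ, rfl, hφ.injOn_ball r hT, fun v hv => hσφ v ?_⟩⟩
    exact hv.trans (Nat.le_findGreatest hr (hφ.injOn_ball r hT))
  · obtain ⟨σ, hσ, -⟩ := exists_injective_leftInvOn (α := BetheVertex d) (β := V) (S := ∅)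
      (φ := fun _ => o) Set.finite_empty (Set.injOn_empty _)
    exact ⟨σ, hσ, fun h => absurd h hG⟩

theorem exists_radius {d : ℕ} (s : Finset (BetheVertex d)) : ∃ r, ∀ v ∈ s, v.1.length ≤ r :=
  ⟨s.sup fun v => v.1.length, fun _ hv => Finset.le_sup (f := fun v => v.1.length) hv⟩

/-- For a fixed potential on the tree, the diagonal resolvent entry of a graph whose ball around
`o` carries that potential is close to the one of the tree, uniformly over all such graphs. -/
theorem exists_radius_norm_sub_lt {d : ℕ} {t : ℝ} {z : ℂ} (hz : 0 < z.im) {g : BetheVertex d → ℝ}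
    {R : ℓ²(BetheVertex d, ℂ) →L[ℂ] ℓ²(BetheVertex d, ℂ)}
    (hR : IsResolventAt (betheHamiltonian d t g) z R) {δ : ℝ} (hδ : 0 < δ) :
    ∃ r, ∀ (N : ℕ) (G : SimpleGraph (Fin N)) (o : Fin N) (σ : Fin N → BetheVertex d),
      IsBallLabelling G o σ r →
        ‖matrixResolvent (andersonMatrix t G (g ∘ σ)) z o o
          - inner ℂ (betheDelta (betheRoot d)) (R (betheDelta (betheRoot d)))‖ < δ := by
  obtain ⟨f, hf1, hf2⟩ := exists_finsupp_approx hR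
    (lt_min (half_pos hδ) (mul_pos hz (half_pos hδ)))
  obtain ⟨r₁, hr₁⟩ := exists_radius f.support
  obtain ⟨r₂, hr₂⟩ := exists_radius (finsuppHamiltonian t z g f).support
  refine ⟨max r₁ r₂, fun N G o σ ⟨φ, hφ, ho, hinj, hσ⟩ => ?_⟩
  subst ho
  have h1 := hφ.norm_matrixResolvent_sub_le t hz (g ∘ σ) g f {v | v.1.length ≤ max r₁ r₂} hinj
    (fun v hv => congrArg g (hσ v hv)) (Nat.zero_le _)
    (fun v hv => (hr₁ v hv).trans (le_max_left _ _))
    (fun v hv => (hr₂ v hv).trans (le_max_right _ _))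
  have h2 := lt_of_mul_lt_mul_left (h1.trans_lt (hf1.trans_le (min_le_right _ _))) hz.le
  have h3 := hf2.trans_le (min_le_left _ _)
  calc _ ≤ _ := norm_sub_le_norm_sub_add_norm_sub _ (f (betheRoot d)) _
    _ < δ / 2 + δ / 2 := add_lt_add h2 h3
    _ = δ := add_halves δ

/-! ### Probability estimates -/

theorem uniformRegularGraph_not_regular {d N : ℕ} :
    uniformRegularGraph d N {G | ¬ ∀ a, (G.neighborSet a).ncard = d} = 0 := by
  rw [uniformRegularGraph_eq, uniformOn, cond_apply (Set.toFinite _).measurableSet]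
  have : {G : SimpleGraph (Fin N) | ∀ a, (G.neighborSet a).ncard = d} ∩
      {G | ¬ ∀ a, (G.neighborSet a).ncard = d} = ∅ := Set.inter_compl_self _
  rw [this]
  simp

/-- A random regular graph looks like a tree around a given vertex, up to probability `O(1/N)`. -/
theorem uniformRegularGraph_not_isTreeLikeAt_le {d : ℕ} (hd : 1 ≤ d) (r : ℕ) :
    ∃ K : ℕ, ∀ (N : ℕ) (o : Fin N), uniformRegularGraph d N
      {G | ¬ ((∀ a, (G.neighborSet a).ncard = d) ∧ IsTreeLikeAt G o r)} ≤ (K : ENNReal) / N := by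
  choose K hK using fun w : ℕ × ℕ => uniformRegularGraph_hasExcessEdge_le hd w.1 w.2
  set I := Finset.range (r + 1) ×ˢ Finset.range (r + 2) with hI
  refine ⟨∑ w ∈ I, K w, fun N o => ?_⟩
  have hsub : {G : SimpleGraph (Fin N) | ¬ ((∀ a, (G.neighborSet a).ncard = d) ∧
      IsTreeLikeAt G o r)} ⊆ {G | ¬ ∀ a, (G.neighborSet a).ncard = d} ∪
        ⋃ w ∈ I, {G | HasExcessEdge G o w.1 w.2} := by
    intro G hG
    by_cases h : ∀ a, (G.neighborSet a).ncard = d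
    · right
      have h1 : ¬ IsTreeLikeAt G o r := fun h' => hG ⟨h, h'⟩
      simp only [IsTreeLikeAt, not_forall, not_not] at h1
      obtain ⟨n, hn, m, hm, h2⟩ := h1
      refine Set.mem_biUnion (x := (n, m)) ?_ h2
      simp only [hI, Finset.coe_product, Set.mem_prod, Finset.mem_coe, Finset.mem_range]
      omega
    · exact Or.inl h
  calc _ ≤ _ := measure_mono hsub
    _ ≤ _ := measure_union_le _ _
    _ ≤ 0 + ∑ w ∈ I, (K w : ENNReal) / N := by
        gcongr
        · exact uniformRegularGraph_not_regular.le
        · exact (measure_biUnion_finset_le _ _).trans (Finset.sum_le_sum fun w _ => hK w N o)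
    _ = _ := by
        rw [zero_add]
        simp only [div_eq_mul_inv]
        rw [← Finset.sum_mul]
        push_cast
        rfl

/-- An injective family of coordinates of an i.i.d. family is i.i.d. -/
theorem map_comp_infinitePi {ι κ : Type*} [Fintype κ] (ν : Measure ℝ) [IsProbabilityMeasure ν]
    {σ : κ → ι} (hσ : Function.Injective σ) :
    Measure.map (fun g : ι → ℝ => g ∘ σ) (Measure.infinitePi fun _ => ν)
      = Measure.pi fun _ => ν := by
  have h1 : iIndepFun (fun (i : ι) (g : ι → ℝ) => g i) (Measure.infinitePi fun _ => ν) :=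
    iIndepFun_infinitePi (X := fun _ => id) fun _ => measurable_id
  have h2 := (iIndepFun_iff_map_fun_eq_pi_map
    fun i => (measurable_pi_apply (σ i)).aemeasurable).1 (h1.precomp hσ)
  simp only [Measure.infinitePi_map_eval] at h2
  exact h2

theorem measurable_matrixResolvent {N : ℕ} (t : ℝ) (G : SimpleGraph (Fin N)) (z : ℂ)
    (o : Fin N) :
    Measurable fun V : Fin N → ℝ => matrixResolvent (andersonMatrix t G V) z o o := by
  have h1 : Continuous fun V : Fin N → ℝ => shiftedAnderson t G V z := by
    refine continuous_matrix fun i j => ?_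
    simp only [shiftedAnderson_apply]
    by_cases h : i = j
    · simp only [h, if_true]
      fun_prop
    · simp only [h, if_false]
      fun_prop
  have h2 : (fun V : Fin N → ℝ => matrixResolvent (andersonMatrix t G V) z o o)
      = fun V => ((shiftedAnderson t G V z).det)⁻¹ * (shiftedAnderson t G V z).adjugate o o := by
    funext V
    change (shiftedAnderson t G V z)⁻¹ o o = _
    rw [Matrix.inv_def, Ring.inverse_eq_inv']
    rfl
  rw [h2]
  exact h1.matrix_det.measurable.inv.mul (h1.matrix_adjugate.matrix_elem o o).measurable

theorem tendsto_regularSize_atTop (d : ℕ) :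
    Tendsto (fun N : RegularSize d => N.1) atTop atTop := by
  refine tendsto_atTop.2 fun b => ?_
  have h : d + 1 ≤ 2 * (b + d + 1) ∧ Even (2 * (b + d + 1) * d) :=
    ⟨by omega, by rw [mul_assoc]; exact even_two_mul _⟩
  filter_upwards [eventually_ge_atTop (⟨2 * (b + d + 1), h⟩ : RegularSize d)] with N hN
  have : 2 * (b + d + 1) ≤ N.1 := hN
  omega

instance (d : ℕ) : (atTop : Filter (RegularSize d)).NeBot := by
  have : Nonempty (RegularSize d) :=
    ⟨⟨2 * (d + 1), by omega, by rw [mul_assoc]; exact even_two_mul _⟩⟩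
  infer_instance

theorem tendsto_natCast_div_regularSize (d K : ℕ) :
    Tendsto (fun N : RegularSize d => (K : ENNReal) / N.1) atTop (nhds 0) := by
  have h1 : Tendsto (fun N : ℕ => (K : ENNReal) / N) atTop (nhds 0) :=
    by simpa [div_eq_mul_inv] using
      ENNReal.Tendsto.const_mul ENNReal.tendsto_inv_nat_nhds_zero
        (Or.inr (ENNReal.natCast_ne_top K))
  exact h1.comp (tendsto_regularSize_atTop d)

/-! ### The coupling -/

/-- The event that `G` is regular and looks like a tree around `o` has almost full probability. -/
theorem tendsto_uniformRegularGraph_not_isTreeLikeAt {d : ℕ} (hd : 1 ≤ d) (r : ℕ) :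
    Tendsto (fun N : RegularSize d => uniformRegularGraph d N.1
      {G | ¬ ((∀ a, (G.neighborSet a).ncard = d) ∧ IsTreeLikeAt G (firstVertex N) r)}) atTop
      (nhds 0) := by
  obtain ⟨K, hK⟩ := uniformRegularGraph_not_isTreeLikeAt_le hd r
  exact tendsto_of_tendsto_of_tendsto_of_le_of_le tendsto_const_nhds
    (tendsto_natCast_div_regularSize d K) (fun _ => zero_le) fun N => hK N.1 _

/-- Graphs that look like a tree on ever larger balls exist. -/
theorem exists_isTreeLikeAt {d : ℕ} (hd : 1 ≤ d) (r : ℕ) :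
    ∃ N : RegularSize d, r ≤ N.1 ∧ ∃ G : SimpleGraph (Fin N.1),
      (∀ a, (G.neighborSet a).ncard = d) ∧ IsTreeLikeAt G (firstVertex N) r := by
  obtain ⟨N, hN1, hN2⟩ := (((tendsto_uniformRegularGraph_not_isTreeLikeAt hd r).eventually_lt_const
    one_pos).and ((tendsto_regularSize_atTop d).eventually_ge_atTop r)).exists
  refine ⟨N, hN2, ?_⟩
  by_contra! h
  have := isProbabilityMeasure_uniformRegularGraph N.2.1 N.2.2
  have h1 : {G : SimpleGraph (Fin N.1) | ¬ ((∀ a, (G.neighborSet a).ncard = d) ∧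
      IsTreeLikeAt G (firstVertex N) r)} = Set.univ :=
    Set.eq_univ_of_forall fun G hG => h G hG.1 hG.2
  rw [h1, measure_univ] at hN1
  exact lt_irrefl _ hN1

theorem lemma3p3 (d : ℕ) (hd : 3 ≤ d) (t : ℝ) (ht : 0 < t) (z : ℂ) (hz : 0 < z.im) :
    ∃ (Ω : Type) (_ : MeasurableSpace Ω) (P : Measure Ω) (_ : IsProbabilityMeasure P)
      (𝒢 : ∀ N : RegularSize d, Ω → SimpleGraph (Fin N.1))
      (V : ∀ N : RegularSize d, Ω → Fin N.1 → ℝ)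
      (g : Ω → BetheVertex d → ℝ)
      (R : Ω → ℓ²(BetheVertex d, ℂ) →L[ℂ] ℓ²(BetheVertex d, ℂ)),
      -- for each `N`, `andersonMatrix t (𝒢 N) (V N)` is distributed as `W_{N,t}`
      (∀ N, HasLaw (𝒢 N) (uniformRegularGraph d N.1) P ∧
        HasLaw (V N) (Measure.pi fun _ => gaussianReal 0 1) P ∧
        IndepFun (𝒢 N) (V N) P) ∧
      -- `betheHamiltonian d t g` is distributed as `H_{d,t}`, and `R` is its resolvent at `z`
      HasLaw g (Measure.infinitePi fun _ => gaussianReal 0 1) P ∧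
      (∀ ω, IsResolventAt (betheHamiltonian d t (g ω)) z (R ω)) ∧
      -- `G₁₁(z) → R₀₀(z)` in probability as `N → ∞`
      TendstoInMeasure P
        (fun N ω =>
          matrixResolvent (andersonMatrix t (𝒢 N ω) (V N ω)) z (firstVertex N) (firstVertex N))
        atTop
        (fun ω => inner ℂ (betheDelta (betheRoot d)) (R ω (betheDelta (betheRoot d)))) := by
  have hd1 : 1 ≤ d := by omega
  have hprob : ∀ N : RegularSize d, IsProbabilityMeasure (uniformRegularGraph d N.1) := fun N =>
    isProbabilityMeasure_uniformRegularGraph N.2.1 N.2.2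
  choose R hR using fun g : BetheVertex d → ℝ => exists_isResolventAt (d := d) hz.ne' t g
  choose σ hσinj hσ using fun (N : RegularSize d) (G : SimpleGraph (Fin N.1)) =>
    exists_labelling (d := d) (by omega) N.1 G (firstVertex N)
  let Q : Measure (∀ N : RegularSize d, SimpleGraph (Fin N.1)) :=
    Measure.infinitePi fun N => uniformRegularGraph d N.1
  let μ : Measure (BetheVertex d → ℝ) := Measure.infinitePi fun _ => gaussianReal 0 1
  let F : ∀ N : RegularSize d, SimpleGraph (Fin N.1) → (BetheVertex d → ℝ) → ℂ := fun N G g =>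
    matrixResolvent (andersonMatrix t G (g ∘ σ N G)) z (firstVertex N) (firstVertex N)
  let R₀ : (BetheVertex d → ℝ) → ℂ := fun g =>
    inner ℂ (betheDelta (betheRoot d)) (R g (betheDelta (betheRoot d)))
  have hcomp : ∀ N : RegularSize d, ∀ G, Measurable fun g : BetheVertex d → ℝ => g ∘ σ N G :=
    fun N G => measurable_pi_iff.2 fun x => measurable_pi_apply _
  have hclose : ∀ (g : BetheVertex d → ℝ) (δ : ℝ), 0 < δ → ∃ r, ∀ (N : RegularSize d) (G),
      r ≤ N.1 → (∀ a, (G.neighborSet a).ncard = d) → IsTreeLikeAt G (firstVertex N) r →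
        ‖F N G g - R₀ g‖ < δ := by
    intro g δ hδ
    obtain ⟨r, hr⟩ := exists_radius_norm_sub_lt hz (hR g) hδ
    exact ⟨r, fun N G hN hG hT => hr N.1 G _ _ (hσ N G hG r hN hT)⟩
  have hFmeas : ∀ N G, Measurable (F N G) := fun N G =>
    (measurable_matrixResolvent t G z (firstVertex N)).comp (hcomp N G)
  -- the tree resolvent is a limit of resolvents of finite graphs, hence measurable
  have hR₀meas : Measurable R₀ := by
    choose M hM H hH1 hH2 using fun r => exists_isTreeLikeAt hd1 r
    refine measurable_of_tendsto_metrizable (fun k => hFmeas (M k) (H k)) ?_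
    refine tendsto_pi_nhds.2 fun g => Metric.tendsto_atTop.2 fun δ hδ => ?_
    obtain ⟨r, hr⟩ := hclose g δ hδ
    refine ⟨r, fun k hk => ?_⟩
    rw [dist_eq_norm]
    exact hr (M k) (H k) (hk.trans (hM k)) (hH1 k) ((hH2 k).mono hk)
  have hpair : ∀ N : RegularSize d, Measurable
      (fun ω : (∀ N : RegularSize d, SimpleGraph (Fin N.1)) × (BetheVertex d → ℝ) =>
        (ω.1 N, ω.2)) := by
    intro N
    have h : Measurable fun 𝒢 : ∀ N : RegularSize d, SimpleGraph (Fin N.1) => 𝒢 N :=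
      measurable_pi_apply N
    exact (h.comp measurable_fst).prodMk measurable_snd
  -- given the graphs, the potential on the graph is a family of distinct coordinates of `g`
  have hjoint : ∀ N : RegularSize d, MeasurePreserving
      (fun ω : (∀ N : RegularSize d, SimpleGraph (Fin N.1)) × (BetheVertex d → ℝ) =>
        (ω.1 N, ω.2 ∘ σ N (ω.1 N))) (Q.prod μ)
      ((uniformRegularGraph d N.1).prod (Measure.pi fun _ => gaussianReal 0 1)) := by
    intro N
    refine (measurePreserving_eval_infinitePi (fun N : RegularSize d =>
      uniformRegularGraph d N.1) N).skew_product (g := fun 𝒢 g => g ∘ σ N (𝒢 N)) ?_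
      (Eventually.of_forall fun 𝒢 => map_comp_infinitePi _ (hσinj N _))
    have h1 : Measurable fun w : SimpleGraph (Fin N.1) × (BetheVertex d → ℝ) => w.2 ∘ σ N w.1 :=
      measurable_from_prod_countable_right fun G => hcomp N G
    exact h1.comp (hpair N)
  have hG : ∀ N : RegularSize d, HasLaw (fun ω : (∀ N : RegularSize d, SimpleGraph (Fin N.1)) ×
      (BetheVertex d → ℝ) => ω.1 N) (uniformRegularGraph d N.1) (Q.prod μ) := fun N =>
    (measurePreserving_fst.comp (hjoint N)).hasLaw
  have hV : ∀ N : RegularSize d, HasLaw (fun ω : (∀ N : RegularSize d, SimpleGraph (Fin N.1)) ×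
      (BetheVertex d → ℝ) => ω.2 ∘ σ N (ω.1 N)) (Measure.pi fun _ => gaussianReal 0 1)
      (Q.prod μ) := fun N => (measurePreserving_snd.comp (hjoint N)).hasLaw
  refine ⟨(∀ N : RegularSize d, SimpleGraph (Fin N.1)) × (BetheVertex d → ℝ), inferInstance,
    Q.prod μ, inferInstance, fun N ω => ω.1 N, fun N ω => ω.2 ∘ σ N (ω.1 N), fun ω => ω.2,
    fun ω => R ω.2, fun N => ⟨hG N, hV N, ?_⟩, measurePreserving_snd.hasLaw, fun ω => hR ω.2, ?_⟩
  · rw [indepFun_iff_map_prod_eq_prod_map_map (hG N).aemeasurable (hV N).aemeasurable,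
      (hG N).map_eq, (hV N).map_eq]
    exact (hjoint N).map_eq
  · rw [tendstoInMeasure_iff_norm]
    intro δ hδ
    have hset : ∀ N : RegularSize d, MeasurableSet {w : SimpleGraph (Fin N.1) ×
        (BetheVertex d → ℝ) | δ ≤ ‖F N w.1 w.2 - R₀ w.2‖} := fun N =>
      measurableSet_le measurable_const (((measurable_from_prod_countable_right
        (f := fun w : SimpleGraph (Fin N.1) × (BetheVertex d → ℝ) => F N w.1 w.2)
        (hFmeas N)).sub (hR₀meas.comp measurable_snd)).norm)
    have hset' : ∀ N : RegularSize d, MeasurableSet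
        {ω : (∀ N : RegularSize d, SimpleGraph (Fin N.1)) × (BetheVertex d → ℝ) |
          δ ≤ ‖F N (ω.1 N) ω.2 - R₀ ω.2‖} := fun N =>
      hpair N (hset N)
    -- the probability over the graphs alone, for a fixed potential
    have hfub : ∀ N : RegularSize d, (Q.prod μ)
        {ω | δ ≤ ‖F N (ω.1 N) ω.2 - R₀ ω.2‖}
          = ∫⁻ g, uniformRegularGraph d N.1 {G | δ ≤ ‖F N G g - R₀ g‖} ∂μ := by
      intro N
      rw [Measure.prod_apply_symm (hset' N)]
      refine lintegral_congr fun g => ?_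
      exact (measurePreserving_eval_infinitePi (fun N : RegularSize d =>
        uniformRegularGraph d N.1) N).measure_preimage
          (MeasurableSet.of_discrete (s := {G | δ ≤ ‖F N G g - R₀ g‖})).nullMeasurableSet
    change Tendsto (fun N : RegularSize d => (Q.prod μ)
        {ω | δ ≤ ‖F N (ω.1 N) ω.2 - R₀ ω.2‖}) atTop (nhds 0)
    simp only [hfub]
    rw [← lintegral_zero (μ := μ)]
    refine tendsto_lintegral_filter_of_dominated_convergence (fun _ => 1)
      (Eventually.of_forall fun N => ?_)
      (Eventually.of_forall fun N => Eventually.of_forall fun g => prob_le_one) (by simp)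
      (Eventually.of_forall fun g => ?_)
    · exact measurable_measure_prodMk_right (hset N)
    · obtain ⟨r, hr⟩ := hclose g δ hδ
      refine tendsto_of_tendsto_of_tendsto_of_le_of_le' tendsto_const_nhds
        (tendsto_uniformRegularGraph_not_isTreeLikeAt hd1 r)
        (Eventually.of_forall fun _ => zero_le) ?_
      filter_upwards [(tendsto_regularSize_atTop d).eventually_ge_atTop r] with N hN
      refine measure_mono fun G hG h => ?_
      exact absurd (hr N G hN h.1 h.2) (not_lt.2 hG)
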